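/- Let $H_0,H_1$ be Hermitian $n\times n$ matrices such that the Hamiltonian is ideal: in an orthonormal eigenbasis of $H_0$, with eigenvalues $a_1,\dots,a_n$, the numbers $\omega_{k\ell}=a_\ell-a_k$ $(k\neq\ell)$ are pairwise distinct and all off-diagonal entries of $H_1$ are non-zero. Let $\rho_d(t)$, $t\ge 0$, be a solution of $\dot\rho_d=-i[H_0,\rho_d]$ such that $\rho_d(0)$ is a density matrix (positive semidefinite, trace one) with $n$ distinct eigenvalues (generic) and $[H_0,\rho_d(0)]\ne 0$ (non-stationary). Let $\mathcal M$ be the set of density matrices with the same spectrum as $\rho_d(0)$, $\|A\|=\sqrt{\operatorname{Tr}(A^\dagger A)}$, $V(\rho_1,\rho_2)=\tfrac12\|\rho_1-\rho_2\|^2$, and consider the system on $\mathcal M\times\mathcal M$ $$\dot\rho=-i[H_0+f(\rho,\rho_d)H_1,\rho],\qquad \dot\rho_d=-i[H_0,\rho_d],\qquad f(\rho,\rho_d)=\operatorname{Tr}([-iH_1,\rho]\rho_d).$$ Let $E$ be the set of pairs $(\rho_1,\rho_2)$, with $\rho_1\in\mathcal M$ and $\rho_2$ on the orbit $\{\rho_d(t):t\ge0\}$,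 such that $\dot V\equiv 0$ along the solution of this system starting at $(\rho_1,\rho_2)$. Assume that $E$ is regular, i.e. $[\rho_1,\rho_2]=0$ for all $(\rho_1,\rho_2)\in E$. A trajectory means a solution $\rho(t)$, $t\ge 0$, of the first equation, with the given $\rho_d(t)$ and $\rho(0)\in\mathcal M$. Then the function $V(\cdot,\rho_d(0))$ on $\mathcal M$ has exactly $n!$ critical points $\rho_d^{(k)}(0)$, $k=1,\dots,n!$. Their evolutions $\rho_d^{(k)}(t)$ under $\dot\rho=-i[H_0,\rho]$ (the critical trajectories) are trajectories, and $\rho_d^{(k)}(t)$ is a critical point of $V(\cdot,\rho_d(t))$ for every $t\ge0$. For every trajectory $\rho(t)$ there is a $k$ with $\|\rho(t)-\rho_d^{(k)}(t)\|\to0$ as $t\to\infty$. Moreover: 1. one of the critical trajectories is $\rho_d(t)$ itself, and it is locally asymptotically stable: it is Lyapunov stable, and all trajectories starting sufficiently close to $\rho_d(0)$ converge to it; 2. exactly one point of $\mathcal M$ is a global maximum of $V(\cdot,\rho_d(0))$; it is a critical point different from $\rho_d(0)$, and its critical trajectory $c(t)$ is repulsive: there is $\varepsilon>0$ such that every trajectory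 with $0<\|\rho(0)-c(0)\|<\varepsilon$ satisfies $\|\rho(t)-c(t)\|\ge\varepsilon$ for all sufficiently large $t$; 3. all critical trajectories other than $\rho_d(t)$ are unstable, i.e. not Lyapunov stable. Stability here refers to perturbations of $\rho(0)$ within $\mathcal M$, the target trajectory $\rho_d(t)$ being fixed. -/

import Mathlib

open Set Filter Topology
open scoped ComplexOrder

/- The norm on matrices is the Hilbert-Schmidt norm `‖A‖ = √(Tr (Aᴴ A))`. -/
attribute [local instance] Matrix.frobeniusNormedAddCommGroup Matrix.frobeniusNormedSpace

noncomputable section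

namespace LyapunovControl

/-- Complex `n × n` matrices, i.e. operators on `ℂⁿ`. -/
abbrev Mat (n : ℕ) : Type := Matrix (Fin n) (Fin n) ℂ

variable {n : ℕ}

/-- Density operators: positive (semidefinite, Hermitian) operators of trace one. -/
def IsDensity (ρ : Mat n) : Prop := ρ.PosSemidef ∧ ρ.trace = 1

/-- A state is generic if it has `n` distinct eigenvalues. -/
def IsGeneric (ρ : Mat n) : Prop := (spectrum ℂ ρ).ncard = n

/-- The state space: density operators with the same spectrum (counted with multiplicity)
as `ρd`. -/
def isospectral (ρd : Mat n) : Set (Mat n) :=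
  {ρ | IsDensity ρ ∧ ρ.charpoly = ρd.charpoly}

/-- The Hamiltonian `H₀ + f H₁` is ideal: in an orthonormal eigenbasis of `H₀`
(the columns of `U`), with eigenvalues `a k`, the transition frequencies
`ω k l = a l - a k` (`k ≠ l`) are pairwise distinct, and all off-diagonal entries of `H₁`
are non-zero. -/
def IsIdeal (H₀ H₁ : Mat n) : Prop :=
  ∃ U ∈ Matrix.unitaryGroup (Fin n) ℂ, ∃ a : Fin n → ℝ,
    star U * H₀ * U = Matrix.diagonal (fun k => (a k : ℂ)) ∧
    (∀ k l p q : Fin n, k ≠ l → p ≠ q → a l - a k = a q - a p → k = p ∧ l = q) ∧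
    (∀ k l : Fin n, k ≠ l → (star U * H₁ * U) k l ≠ 0)

/-- The Lyapunov function `V(ρ, ρd) = ½ ‖ρ - ρd‖²`. -/
def lyapunov (ρ ρd : Mat n) : ℝ := (1 / 2) * ‖ρ - ρd‖ ^ 2

/-- The feedback `f(ρ, ρd) = Tr([-i H₁, ρ] ρd)`. For Hermitian `H₁`, `ρ`, `ρd` this trace
is a real number. -/
def feedback (H₁ ρ ρd : Mat n) : ℝ := (⁅(-Complex.I) • H₁, ρ⁆ * ρd).trace.re

/-- `ρ` solves `ρ' = -i [H₀, ρ]` on `[0, ∞)`. -/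
def IsFreeTrajectory (H₀ : Mat n) (ρ : ℝ → Mat n) : Prop :=
  ∀ t : ℝ, 0 ≤ t → HasDerivWithinAt ρ ((-Complex.I) • ⁅H₀, ρ t⁆) (Ici 0) t

/-- `(ρ, ρd)` solves on `[0, ∞)` the autonomous closed-loop system
`ρ' = -i [H₀ + f(ρ, ρd) H₁, ρ]`, `ρd' = -i [H₀, ρd]`. -/
def IsTrajectory (H₀ H₁ : Mat n) (ρ ρd : ℝ → Mat n) : Prop :=
  (∀ t : ℝ, 0 ≤ t → HasDerivWithinAt ρ
    ((-Complex.I) • ⁅H₀ + (feedback H₁ (ρ t) (ρd t) : ℂ) • H₁, ρ t⁆) (Ici 0) t) ∧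
  IsFreeTrajectory H₀ ρd

/-- The LaSalle invariant set of the target trajectory `ρd`: the pairs `(ρ₁, ρ₂)`, with `ρ₁`
isospectral to the target and `ρ₂` on the orbit of the target, such that `V` has derivative
zero at all times along the closed-loop trajectory that starts at `(ρ₁, ρ₂)`. -/
def laSalleSet (H₀ H₁ : Mat n) (ρd : ℝ → Mat n) : Set (Mat n × Mat n) :=
  {p | p.1 ∈ isospectral (ρd 0) ∧ p.2 ∈ ρd '' Ici 0 ∧
    ∃ ρ σ : ℝ → Mat n, IsTrajectory H₀ H₁ ρ σ ∧ ρ 0 = p.1 ∧ σ 0 = p.2 ∧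
      ∀ t : ℝ, 0 ≤ t → HasDerivWithinAt (fun s => lyapunov (ρ s) (σ s)) 0 (Ici 0) t}

/-- A set of pairs is regular if it only contains pairs with zero commutator. -/
def IsRegular (E : Set (Mat n × Mat n)) : Prop := ∀ p ∈ E, ⁅p.1, p.2⁆ = 0

/-- `ρ₀` is a critical point of `V(·, ρd)` on the manifold of states isospectral to `ρd`:
the derivative of `V(·, ρd)` vanishes along every curve in the manifold that passes
differentiably through `ρ₀`. -/
def IsCriticalPoint (ρd ρ₀ : Mat n) : Prop :=
  ρ₀ ∈ isospectral ρd ∧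
  ∀ γ : ℝ → Mat n, (∀ t, γ t ∈ isospectral ρd) → γ 0 = ρ₀ → DifferentiableAt ℝ γ 0 →
    HasDerivAt (fun t => lyapunov (γ t) ρd) 0 0

/-- The critical trajectories: the free evolutions of the critical points of
`V(·, ρd(0))`. -/
def IsCriticalTrajectory (H₀ : Mat n) (ρd c : ℝ → Mat n) : Prop :=
  IsFreeTrajectory H₀ c ∧ IsCriticalPoint (ρd 0) (c 0)

/-- `ρ` is an admissible trajectory for the target `ρd`: a closed-loop trajectory whose
initial state is isospectral to the target. -/
def IsAdmissible (H₀ H₁ : Mat n) (ρd ρ : ℝ → Mat n) : Prop :=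
  IsTrajectory H₀ H₁ ρ ρd ∧ ρ 0 ∈ isospectral (ρd 0)

/-- `ρ(t)` converges to the trajectory `c(t)`. -/
def ConvergesTo (ρ c : ℝ → Mat n) : Prop :=
  Tendsto (fun t => ‖ρ t - c t‖) atTop (𝓝 0)

/-- Lyapunov stability of the trajectory `c`. -/
def IsStable (H₀ H₁ : Mat n) (ρd c : ℝ → Mat n) : Prop :=
  ∀ ε > 0, ∃ δ > 0, ∀ ρ, IsAdmissible H₀ H₁ ρd ρ → ‖ρ 0 - c 0‖ < δ →
    ∀ t : ℝ, 0 ≤ t → ‖ρ t - c t‖ < ε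

/-- Local asymptotic stability of the trajectory `c`. -/
def IsLocallyAsymptoticallyStable (H₀ H₁ : Mat n) (ρd c : ℝ → Mat n) : Prop :=
  IsStable H₀ H₁ ρd c ∧
  ∃ δ > 0, ∀ ρ, IsAdmissible H₀ H₁ ρd ρ → ‖ρ 0 - c 0‖ < δ → ConvergesTo ρ c

/-- The trajectory `c` is repulsive: every trajectory that starts close to `c`, but not on
`c`, eventually leaves a fixed neighbourhood of `c` for good. -/
def IsRepulsive (H₀ H₁ : Mat n) (ρd c : ℝ → Mat n) : Prop :=
  ∃ ε > 0, ∀ ρ, IsAdmissible H₀ H₁ ρd ρ → ρ 0 ≠ c 0 → ‖ρ 0 - c 0‖ < ε →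
    ∃ T : ℝ, 0 ≤ T ∧ ∀ t : ℝ, T ≤ t → ε ≤ ‖ρ t - c t‖

end LyapunovControl

end

/-! On the isospectral manifold `V(ρ, ρd) = Tr ρd² - Tr(ρ ρd)`, and along the closed loop `Tr(ρ ρd)`
has derivative `f²`; so `V` never increases. By genericity the critical points of `V(·, ρd(0))` are
exactly the states commuting with `ρd(0)`, i.e. the `n!` rearrangements of its eigenvalues in its
own eigenbasis (`lie_eq_zero_of_isCriticalPoint`, `isCriticalPoint_permState`,
`eq_permState_of_lie_eq_zero`). With the eigenvalues sorted, `V` at a rearrangement is decided by `∑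
l (τ k) * l k`, so the identity gives the minimum and the reversal the maximum.

For convergence, the free evolution is removed by passing to the interaction picture, where the
velocity is proportional to the feedback and distances to free evolutions become distances to fixed
points. Barbalat's lemma gives `f → 0`, so the interaction picture is asymptotically constant over
bounded times. Take a limit `y` along an ultrafilter, together with a limit of the phases of the
propagator. The feedback then vanishes for all times along a phase-shifted free evolution. Its
frequencies are the `ω k l`, which are distinct, so each off-diagonal coefficient vanishes
separately and the shift can be dropped (`trace_eq_zero_of_shifted_trace_eq_zero`). Hence `(y,
ρd(0))` itself, and not only a pair in the closure of the orbit, lies in the LaSalle set, and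
regularity gives `[y, ρd(0)] = 0`. All limit points lie in a finite set, so by connectedness the
trajectory converges (`IsAdmissible.exists_tendsto_interaction`).

The stability statements follow by comparing `V` at the start with `V` at the limit: near the target
only the target is low enough, off the maximum the limit cannot be the maximum, and every other
critical point has nearby states of lower `V` (`exists_lyapunov_lt`), whose trajectories must end
elsewhere. -/

namespace LyapunovControl

attribute [local instance] Matrix.frobeniusNormedRing Matrix.frobeniusNormedAlgebra

variable {n : ℕ}

/-! ### Traces, norms and unitary conjugation -/

/-- The real part of the trace, as a real-linear functional. -/
noncomputable def reTr : Mat n →ₗ[ℝ] ℝ :=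
  Complex.reLm ∘ₗ Matrix.traceLinearMap (Fin n) ℝ ℂ

lemma reTr_apply (A : Mat n) : reTr A = A.trace.re := rfl

@[fun_prop]
lemma continuous_reTr : Continuous (reTr : Mat n → ℝ) :=
  (LinearMap.toContinuousLinearMap reTr).continuous

lemma hasDerivWithinAt_reTr {f : ℝ → Mat n} {f' : Mat n} {S : Set ℝ} {t : ℝ}
    (h : HasDerivWithinAt f f' S t) :
    HasDerivWithinAt (fun t => reTr (f t)) (reTr f') S t :=
  (LinearMap.toContinuousLinearMap reTr).hasFDerivAt.comp_hasDerivWithinAt t h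

lemma hasDerivAt_reTr {f : ℝ → Mat n} {f' : Mat n} {t : ℝ} (h : HasDerivAt f f' t) :
    HasDerivAt (fun t => reTr (f t)) (reTr f') t :=
  (LinearMap.toContinuousLinearMap reTr).hasFDerivAt.comp_hasDerivAt t h

lemma hasDerivAt_trace {f : ℝ → Mat n} {f' : Mat n} {t : ℝ} (h : HasDerivAt f f' t) :
    HasDerivAt (fun t => (f t).trace) f'.trace t :=
  (LinearMap.toContinuousLinearMap
    (Matrix.traceLinearMap (Fin n) ℝ ℂ)).hasFDerivAt.comp_hasDerivAt t h

lemma reTr_mul_comm (A B : Mat n) : reTr (A * B) = reTr (B * A) := by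
  rw [reTr_apply, reTr_apply, Matrix.trace_mul_comm]

lemma reTr_star (A : Mat n) : reTr (star A) = reTr A := by
  rw [reTr_apply, reTr_apply, Matrix.star_eq_conjTranspose, Matrix.trace_conjTranspose]
  simp

lemma norm_sq_eq_reTr (A : Mat n) : ‖A‖ ^ 2 = reTr (star A * A) := by
  have h : ‖A‖ = Real.sqrt (∑ i, ∑ j, ‖A i j‖ ^ 2) := by
    rw [Matrix.frobenius_norm_def, Real.sqrt_eq_rpow]
    simp
  rw [h, Real.sq_sqrt (by positivity), reTr_apply, Finset.sum_comm]
  simp only [Matrix.trace, Matrix.diag_apply, Matrix.mul_apply, Matrix.star_eq_conjTranspose,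
    Matrix.conjTranspose_apply, Complex.re_sum]
  refine Finset.sum_congr rfl fun i _ => Finset.sum_congr rfl fun j _ => ?_
  rw [Complex.sq_norm, Complex.normSq_apply]
  simp

lemma reTr_I_smul_of_isHermitian {A : Mat n} (hA : A.IsHermitian) :
    reTr (Complex.I • A) = 0 := by
  have h := reTr_star (Complex.I • A)
  have h2 : star (Complex.I • A) = -(Complex.I • A) := by
    rw [star_smul, Matrix.star_eq_conjTranspose, hA.eq]; simp
  rw [h2, map_neg] at h
  linarith

lemma unitary_star_mul {W : Mat n} (hW : W ∈ Matrix.unitaryGroup (Fin n) ℂ) : star W * W = 1 :=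
  Matrix.mem_unitaryGroup_iff'.1 hW

lemma unitary_mul_star {W : Mat n} (hW : W ∈ Matrix.unitaryGroup (Fin n) ℂ) : W * star W = 1 :=
  Matrix.mem_unitaryGroup_iff.1 hW

lemma star_mem_unitary {W : Mat n} (hW : W ∈ Matrix.unitaryGroup (Fin n) ℂ) :
    star W ∈ Matrix.unitaryGroup (Fin n) ℂ := Unitary.star_mem hW

lemma conj_mul_conj {W : Mat n} (hW : W ∈ Matrix.unitaryGroup (Fin n) ℂ) (A B : Mat n) :
    (W * A * star W) * (W * B * star W) = W * (A * B) * star W := by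
  calc _ = W * A * (star W * W) * B * star W := by simp only [mul_assoc]
    _ = _ := by rw [unitary_star_mul hW]; simp only [mul_assoc, mul_one]

lemma conj_pow {W : Mat n} (hW : W ∈ Matrix.unitaryGroup (Fin n) ℂ) (A : Mat n) (m : ℕ) :
    (W * A * star W) ^ m = W * A ^ m * star W := by
  induction m with
  | zero => simp [unitary_mul_star hW]
  | succ k ih => rw [pow_succ, ih, conj_mul_conj hW, pow_succ]

lemma conj_star_conj {W : Mat n} (hW : W ∈ Matrix.unitaryGroup (Fin n) ℂ) (A : Mat n) :
    star W * (W * A * star W) * W = A := by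
  calc _ = (star W * W) * A * (star W * W) := by simp only [mul_assoc]
    _ = _ := by rw [unitary_star_mul hW]; simp

lemma conj_conj_star {W : Mat n} (hW : W ∈ Matrix.unitaryGroup (Fin n) ℂ) (A : Mat n) :
    W * (star W * A * W) * star W = A := by
  simpa using conj_star_conj (star_mem_unitary hW) A

lemma conj_lie_conj {W : Mat n} (hW : W ∈ Matrix.unitaryGroup (Fin n) ℂ) (A B : Mat n) :
    ⁅W * A * star W, W * B * star W⁆ = W * ⁅A, B⁆ * star W := by
  rw [Ring.lie_def, Ring.lie_def, conj_mul_conj hW, conj_mul_conj hW, mul_sub, sub_mul]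

lemma reTr_conj {W : Mat n} (hW : W ∈ Matrix.unitaryGroup (Fin n) ℂ) (A : Mat n) :
    reTr (W * A * star W) = reTr A := by
  rw [reTr_mul_comm, ← mul_assoc, unitary_star_mul hW, one_mul]

lemma star_conj (W A : Mat n) : star (W * A * star W) = W * star A * star W := by
  simp [mul_assoc]

lemma norm_conj {W : Mat n} (hW : W ∈ Matrix.unitaryGroup (Fin n) ℂ) (A : Mat n) :
    ‖W * A * star W‖ = ‖A‖ := by
  rw [← sq_eq_sq₀ (norm_nonneg _) (norm_nonneg _), norm_sq_eq_reTr, norm_sq_eq_reTr, star_conj,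
    conj_mul_conj hW, reTr_conj hW]

lemma norm_conj_sub_conj {W : Mat n} (hW : W ∈ Matrix.unitaryGroup (Fin n) ℂ) (A B : Mat n) :
    ‖W * A * star W - W * B * star W‖ = ‖A - B‖ := by
  rw [← norm_conj hW (A - B), mul_sub, sub_mul]

lemma charpoly_conj {W : Mat n} (hW : W ∈ Matrix.unitaryGroup (Fin n) ℂ) (A : Mat n) :
    (W * A * star W).charpoly = A.charpoly := by
  rw [Matrix.charpoly_mul_comm, ← mul_assoc, unitary_star_mul hW, one_mul]

lemma isDensity_conj {W : Mat n} (hW : W ∈ Matrix.unitaryGroup (Fin n) ℂ) {A : Mat n}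
    (hA : IsDensity A) : IsDensity (W * A * star W) := by
  refine ⟨hA.1.mul_mul_conjTranspose_same W, ?_⟩
  rw [Matrix.trace_mul_comm, ← mul_assoc, unitary_star_mul hW, one_mul, hA.2]

lemma conj_mem_isospectral {W : Mat n} (hW : W ∈ Matrix.unitaryGroup (Fin n) ℂ) {x s : Mat n}
    (hx : x ∈ isospectral s) : W * x * star W ∈ isospectral s :=
  ⟨isDensity_conj hW hx.1, by rw [charpoly_conj hW, hx.2]⟩

lemma isHermitian_of_mem_isospectral {x s : Mat n} (hx : x ∈ isospectral s) : x.IsHermitian :=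
  hx.1.1.isHermitian

/-- Hermitian matrices with the same characteristic polynomial are unitarily equivalent. -/
lemma exists_unitary_conj_of_charpoly_eq {x s : Mat n} (hx : x.IsHermitian) (hs : s.IsHermitian)
    (h : x.charpoly = s.charpoly) :
    ∃ W ∈ Matrix.unitaryGroup (Fin n) ℂ, x = W * s * star W := by
  have he := (hx.eigenvalues_eq_eigenvalues_iff hs).2 h
  have h1 := hx.spectral_theorem
  have h2 := hs.spectral_theorem
  rw [Unitary.conjStarAlgAut_apply] at h1 h2
  rw [he] at h1
  set D : Mat n := Matrix.diagonal (RCLike.ofReal ∘ hs.eigenvalues)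
  have hU := hx.eigenvectorUnitary.2
  have hV := hs.eigenvectorUnitary.2
  set U : Mat n := hx.eigenvectorUnitary.1
  set V : Mat n := hs.eigenvectorUnitary.1
  refine ⟨U * star V, mul_mem hU (star_mem_unitary hV), ?_⟩
  have : star V * s * V = D := by rw [h2]; exact conj_star_conj hV D
  rw [h1, ← this]
  simp only [star_mul, star_star, mul_assoc]

lemma mem_isospectral_iff {s : Mat n} (hs : IsDensity s) {x : Mat n} :
    x ∈ isospectral s ↔ ∃ W ∈ Matrix.unitaryGroup (Fin n) ℂ, x = W * s * star W := by
  constructor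
  · rintro ⟨hx, hc⟩
    exact exists_unitary_conj_of_charpoly_eq hx.1.isHermitian hs.1.isHermitian hc
  · rintro ⟨W, hW, rfl⟩
    exact conj_mem_isospectral hW ⟨hs, rfl⟩

lemma isCompact_unitaryGroup : IsCompact (Matrix.unitaryGroup (Fin n) ℂ : Set (Mat n)) := by
  refine Metric.isCompact_of_isClosed_isBounded (isClosed_unitary (R := Mat n)) ?_
  refine isBounded_iff_forall_norm_le.2 ⟨‖(1 : Mat n)‖, fun W hW => ?_⟩
  rw [← sq_le_sq₀ (norm_nonneg _) (norm_nonneg _), norm_sq_eq_reTr, unitary_star_mul hW,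
    norm_sq_eq_reTr]
  simp

/-- The set is a single orbit of the compact unitary group under conjugation. -/
lemma isCompact_isospectral {s : Mat n} (hs : IsDensity s) : IsCompact (isospectral s) := by
  have h : isospectral s =
      (fun W : Mat n => W * s * star W) '' (Matrix.unitaryGroup (Fin n) ℂ : Set (Mat n)) := by
    ext x
    rw [mem_isospectral_iff hs]
    constructor
    · rintro ⟨W, hW, rfl⟩; exact ⟨W, hW, rfl⟩
    · rintro ⟨W, hW, rfl⟩; exact ⟨W, hW, rfl⟩
  rw [h]
  exact isCompact_unitaryGroup.image (by fun_prop)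

lemma trace_pow_eq_of_mem_isospectral {x s : Mat n} (hs : IsDensity s) (hx : x ∈ isospectral s)
    (m : ℕ) : (x ^ m).trace = (s ^ m).trace := by
  obtain ⟨W, hW, rfl⟩ := (mem_isospectral_iff hs).1 hx
  rw [conj_pow hW, Matrix.trace_mul_comm, ← mul_assoc, unitary_star_mul hW, one_mul]

/-- Expanding the square, the purities `Tr x²` and `Tr s²` agree, so only the overlap varies: `V` is
affine in `x` on the manifold. -/
lemma lyapunov_eq_of_mem_isospectral {x s : Mat n} (hs : IsDensity s) (hx : x ∈ isospectral s) :
    lyapunov x s = reTr (s * s) - reTr (x * s) := by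
  have hxh : star x = x := (isHermitian_of_mem_isospectral hx).eq
  have hsh : star s = s := hs.1.isHermitian.eq
  have h2 : reTr (x * x) = reTr (s * s) := by
    have := trace_pow_eq_of_mem_isospectral hs hx 2
    rw [reTr_apply, reTr_apply, ← pow_two, this, pow_two]
  rw [lyapunov, norm_sq_eq_reTr, star_sub, hxh, hsh, sub_mul, mul_sub, mul_sub, map_sub, map_sub,
    map_sub, h2, reTr_mul_comm s x]
  ring

/-! ### One-parameter unitary groups -/

/-- The unitary group `exp(-i t H)` of the Hermitian matrix `H = U diag(a) U*`. -/
noncomputable def propagator (U : Mat n) (a : Fin n → ℝ) (t : ℝ) : Mat n :=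
  U * Matrix.diagonal (fun k => Complex.exp (-(Complex.I * a k * t))) * star U

variable {U : Mat n} {a : Fin n → ℝ}

lemma propagator_zero (hU : U ∈ Matrix.unitaryGroup (Fin n) ℂ) : propagator U a 0 = 1 := by
  simp [propagator, unitary_mul_star hU]

lemma propagator_add (hU : U ∈ Matrix.unitaryGroup (Fin n) ℂ) (s t : ℝ) :
    propagator U a (s + t) = propagator U a s * propagator U a t := by
  rw [propagator, propagator, propagator, conj_mul_conj hU, Matrix.diagonal_mul_diagonal]
  congr 3
  ext k
  rw [← Complex.exp_add]
  congr 1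
  push_cast
  ring

lemma star_propagator (t : ℝ) : star (propagator U a t) = propagator U a (-t) := by
  rw [propagator, propagator, star_conj, Matrix.star_eq_conjTranspose (Matrix.diagonal _),
    Matrix.diagonal_conjTranspose]
  congr 3
  ext k
  simp [← Complex.exp_conj]

lemma propagator_mem_unitary (hU : U ∈ Matrix.unitaryGroup (Fin n) ℂ) (t : ℝ) :
    propagator U a t ∈ Matrix.unitaryGroup (Fin n) ℂ := by
  rw [Matrix.mem_unitaryGroup_iff, star_propagator, ← propagator_add hU, add_neg_cancel,
    propagator_zero hU]

lemma hasDerivAt_propagator (hU : U ∈ Matrix.unitaryGroup (Fin n) ℂ) (t : ℝ) :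
    HasDerivAt (propagator U a)
      ((-Complex.I) • (U * Matrix.diagonal (fun k => (a k : ℂ)) * star U) * propagator U a t) t := by
  have h : HasDerivAt
      (fun t : ℝ => Matrix.diagonal (fun k => Complex.exp (-(Complex.I * a k * t))))
      (Matrix.diagonal (fun k => (-Complex.I) * (a k : ℂ) *
        Complex.exp (-(Complex.I * a k * t)))) t := by
    have h1 : HasDerivAt (fun t : ℝ => fun k => Complex.exp (-(Complex.I * a k * t)))
        (fun k => (-Complex.I) * (a k : ℂ) * Complex.exp (-(Complex.I * a k * t))) t := by
      rw [hasDerivAt_pi]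
      intro k
      have h2 : HasDerivAt (fun t : ℝ => -(Complex.I * a k * (t : ℂ))) (-(Complex.I * a k)) t := by
        simpa using ((Complex.ofRealCLM.hasDerivAt (x := t)).const_mul (Complex.I * a k)).fun_neg
      refine h2.cexp.congr_deriv ?_
      ring
    exact ((LinearMap.toContinuousLinearMap
      (Matrix.diagonalLinearMap (Fin n) ℝ ℂ)).hasFDerivAt.comp_hasDerivAt t h1)
  have h3 := (h.const_mul U).mul_const (star U)
  refine h3.congr_deriv ?_
  rw [propagator, smul_mul_assoc, conj_mul_conj hU, Matrix.diagonal_mul_diagonal, ← smul_mul_assoc,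
    ← mul_smul_comm]
  congr 2
  rw [← Matrix.diagonal_smul]
  congr 1
  ext k
  simp [mul_assoc]

lemma exists_eq_diagonal {K : Mat n} (hK : K.IsHermitian) :
    ∃ U ∈ Matrix.unitaryGroup (Fin n) ℂ, ∃ a : Fin n → ℝ,
      K = U * Matrix.diagonal (fun k => (a k : ℂ)) * star U := by
  have h1 := hK.spectral_theorem
  rw [Unitary.conjStarAlgAut_apply] at h1
  exact ⟨_, hK.eigenvectorUnitary.2, hK.eigenvalues, h1⟩

/-! ### Critical points of the Lyapunov function -/

lemma exists_unitary_submatrix (τ : Equiv.Perm (Fin n)) :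
    ∃ Q ∈ Matrix.unitaryGroup (Fin n) ℂ, star Q = (τ⁻¹).permMatrix ℂ ∧ Q = τ.permMatrix ℂ ∧
      ∀ A : Mat n, A.submatrix τ τ = Q * A * star Q := by
  have hs : star (τ.permMatrix ℂ) = (τ⁻¹).permMatrix ℂ := by
    rw [Matrix.star_eq_conjTranspose, Matrix.conjTranspose_permMatrix]
  have hc : ∀ A : Mat n, A.submatrix τ τ = τ.permMatrix ℂ * A * star (τ.permMatrix ℂ) := by
    intro A
    rw [hs, Equiv.Perm.permMatrix, Equiv.Perm.permMatrix, PEquiv.toMatrix_toPEquiv_mul,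
      PEquiv.mul_toMatrix_toPEquiv]
    ext i j
    rfl
  refine ⟨τ.permMatrix ℂ, ?_, hs, rfl, hc⟩
  rw [Matrix.mem_unitaryGroup_iff]
  have := hc 1
  rw [mul_one, Matrix.submatrix_one_equiv] at this
  exact this.symm

lemma strictMono_perm_eq_one {τ : Equiv.Perm (Fin n)} (h : StrictMono τ) : τ = 1 := by
  have h1 := (StrictMono.range_inj h strictMono_id).1 (by simp [τ.surjective.range_eq])
  exact Equiv.ext fun x => congrFun h1 x

/-- Sorting the eigenvalues makes the target the identity permutation and the maximum of `V` the
reversal; genericity makes the order strict. -/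
lemma exists_strictMono_diagonal {s : Mat n} (hs : s.IsHermitian) (hg : IsGeneric s) :
    ∃ P ∈ Matrix.unitaryGroup (Fin n) ℂ, ∃ l : Fin n → ℝ, StrictMono l ∧
      s = P * Matrix.diagonal (fun k => (l k : ℂ)) * star P := by
  have h1 := hs.spectral_theorem
  rw [Unitary.conjStarAlgAut_apply] at h1
  have hinj : Function.Injective hs.eigenvalues := by
    have h2 : (range hs.eigenvalues).ncard = n := by
      have h3 := hs.spectrum_eq_image_range
      rw [IsGeneric, h3, ncard_image_of_injective _ RCLike.ofReal_injective] at hg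
      exact hg
    rw [← image_univ, ← Finset.coe_univ, ← Finset.coe_image, ncard_coe_finset] at h2
    have h4 := Finset.card_image_iff.1 (h2.trans (Finset.card_fin n).symm)
    simpa using h4
  obtain ⟨Q, hQ, -, -, hQc⟩ := exists_unitary_submatrix (Tuple.sort hs.eigenvalues)
  refine ⟨_, mul_mem hs.eigenvectorUnitary.2 (star_mem_unitary hQ),
    hs.eigenvalues ∘ Tuple.sort hs.eigenvalues,
    (Tuple.monotone_sort _).strictMono_of_injective (hinj.comp (Equiv.injective _)), ?_⟩
  have h5 := hQc (Matrix.diagonal (RCLike.ofReal ∘ hs.eigenvalues))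
  rw [Matrix.submatrix_diagonal_equiv] at h5
  have h6 : (Matrix.diagonal (fun k =>
      (((hs.eigenvalues ∘ Tuple.sort hs.eigenvalues) k : ℝ) : ℂ)) : Mat n) =
      Q * Matrix.diagonal (RCLike.ofReal ∘ hs.eigenvalues) * star Q := by
    rw [← h5]; rfl
  rw [h6]
  have h7 := conj_star_conj hQ (Matrix.diagonal (RCLike.ofReal ∘ hs.eigenvalues))
  conv_lhs => rw [h1, ← h7]
  simp only [star_mul, star_star, mul_assoc]

/-- The state whose eigenvalues in the eigenbasis `P` are permuted by `τ`. -/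
noncomputable def permState (P : Mat n) (l : Fin n → ℝ) (τ : Equiv.Perm (Fin n)) : Mat n :=
  P * Matrix.diagonal (fun k => (l (τ k) : ℂ)) * star P

section permState

variable {P : Mat n} {l : Fin n → ℝ}

lemma permState_mem_isospectral (hP : P ∈ Matrix.unitaryGroup (Fin n) ℂ)
    (hs : IsDensity (permState P l 1)) (τ : Equiv.Perm (Fin n)) :
    permState P l τ ∈ isospectral (permState P l 1) := by
  obtain ⟨Q, hQ, -, -, hQc⟩ := exists_unitary_submatrix τ
  refine (mem_isospectral_iff hs).2
    ⟨P * Q * star P, mul_mem (mul_mem hP hQ) (star_mem_unitary hP), ?_⟩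
  have h := hQc (Matrix.diagonal (fun k => (l k : ℂ)))
  rw [Matrix.submatrix_diagonal_equiv] at h
  calc permState P l τ
      = P * (Q * Matrix.diagonal (fun k => (l k : ℂ)) * star Q) * star P := by
        rw [← h]; rfl
    _ = (P * Q * star P) * (P * Matrix.diagonal (fun k => (l k : ℂ)) * star P) *
          (P * star Q * star P) := by
        rw [conj_mul_conj hP, conj_mul_conj hP]
    _ = _ := by simp [permState, mul_assoc]

lemma permState_injective (hP : P ∈ Matrix.unitaryGroup (Fin n) ℂ) (hl : StrictMono l) :
    Function.Injective (permState P l) := by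
  intro τ τ' h
  have h1 : star P * permState P l τ * P = star P * permState P l τ' * P := by rw [h]
  rw [permState, permState, conj_star_conj hP, conj_star_conj hP] at h1
  have h2 := Matrix.diagonal_injective h1
  ext k
  have h3 := congrFun h2 k
  exact congrArg Fin.val (hl.injective (Complex.ofReal_injective h3))

lemma lie_permState (hP : P ∈ Matrix.unitaryGroup (Fin n) ℂ) (τ τ' : Equiv.Perm (Fin n)) :
    ⁅permState P l τ, permState P l τ'⁆ = 0 := by
  rw [permState, permState, conj_lie_conj hP, Ring.lie_def, Matrix.diagonal_mul_diagonal,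
    Matrix.diagonal_mul_diagonal]
  simp [mul_comm]

/-- A matrix commuting with a diagonal matrix with distinct entries is diagonal; comparing the roots
of the characteristic polynomials shows that its entries rearrange `l`. -/
lemma eq_permState_of_lie_eq_zero (hP : P ∈ Matrix.unitaryGroup (Fin n) ℂ) (hl : StrictMono l)
    {x : Mat n} (hx : x ∈ isospectral (permState P l 1)) (h : ⁅x, permState P l 1⁆ = 0) :
    ∃ τ, x = permState P l τ := by
  set y := star P * x * P with hy
  have hxy : x = P * y * star P := (conj_conj_star hP x).symm
  have hcomm : y * Matrix.diagonal (fun k => (l k : ℂ)) =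
      Matrix.diagonal (fun k => (l k : ℂ)) * y := by
    rw [hxy, permState, conj_lie_conj hP] at h
    have h1 := conj_star_conj hP ⁅y, Matrix.diagonal (fun k => (l ((1 : Equiv.Perm (Fin n)) k) : ℂ))⁆
    rw [h] at h1
    simp only [mul_zero, zero_mul] at h1
    rw [Ring.lie_def] at h1
    exact sub_eq_zero.1 h1.symm
  have hdiag : y = Matrix.diagonal y.diag := by
    ext i j
    rcases eq_or_ne i j with rfl | hij
    · simp
    · have h2 := congrFun (congrFun hcomm i) j
      rw [Matrix.mul_diagonal, Matrix.diagonal_mul, mul_comm] at h2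
      rw [Matrix.diagonal_apply_ne _ hij]
      have h3 : ((l j : ℂ) - l i) * y i j = 0 := by rw [sub_mul, h2, sub_self]
      refine (mul_eq_zero.1 h3).resolve_left ?_
      exact fun h => hij (hl.injective (Complex.ofReal_injective (sub_eq_zero.1 h))).symm
  have hcp : (Matrix.diagonal y.diag).charpoly =
      (Matrix.diagonal (fun k => (l k : ℂ))).charpoly := by
    have := hx.2
    rw [hxy, charpoly_conj hP, permState, charpoly_conj hP, hdiag] at this
    simpa using this
  rw [Matrix.charpoly_diagonal, Matrix.charpoly_diagonal] at hcp
  have hroots := congrArg Polynomial.roots hcp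
  have hr : ∀ f : Fin n → ℂ, (∏ i, (Polynomial.X - Polynomial.C (f i))).roots =
      Finset.univ.val.map f := fun f => by
    rw [← Polynomial.roots_multiset_prod_X_sub_C (Finset.univ.val.map f), Multiset.map_map]
    rfl
  rw [hr, hr] at hroots
  have hbij : ∀ k, ∃ j, (l j : ℂ) = y k k := fun k => by
    have : y k k ∈ Finset.univ.val.map (fun k => (l k : ℂ)) := by
      rw [← hroots, Multiset.mem_map]
      exact ⟨k, by simp, rfl⟩
    obtain ⟨j, -, hj⟩ := Multiset.mem_map.1 this
    exact ⟨j, hj⟩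
  choose f hf using hbij
  have hnodup : (Finset.univ.val.map y.diag).Nodup := by
    rw [hroots]
    exact Finset.univ.nodup.map (Complex.ofReal_injective.comp hl.injective)
  have hfinj : Function.Injective f := by
    intro i j hij
    refine Multiset.inj_on_of_nodup_map hnodup i (by simp) j (by simp) ?_
    rw [Matrix.diag_apply, Matrix.diag_apply, ← hf, ← hf, hij]
  refine ⟨Equiv.ofBijective f (Finite.injective_iff_bijective.1 hfinj), ?_⟩
  rw [permState, hxy, hdiag]
  congr 3
  ext k
  simp [hf]

lemma reTr_permState_mul (hP : P ∈ Matrix.unitaryGroup (Fin n) ℂ) (τ τ' : Equiv.Perm (Fin n)) :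
    reTr (permState P l τ * permState P l τ') = ∑ k, l (τ k) * l (τ' k) := by
  rw [permState, permState, conj_mul_conj hP, reTr_conj hP, Matrix.diagonal_mul_diagonal,
    reTr_apply, Matrix.trace_diagonal, Complex.re_sum]
  exact Finset.sum_congr rfl fun k _ => by rw [← Complex.ofReal_mul, Complex.ofReal_re]

/-- One step of the rearrangement inequality: only the terms at `i` and `j` change, and the gain
factors as a product of two positive differences. -/
lemma sum_swap_lt (hl : StrictMono l) {τ : Equiv.Perm (Fin n)} {i j : Fin n} (hij : i < j)
    (hτ : τ j < τ i) :
    ∑ k, l (τ k) * l k < ∑ k, l ((τ * Equiv.swap i j) k) * l k := by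
  rw [← sub_pos, ← Finset.sum_sub_distrib]
  have h : ∑ k, (l ((τ * Equiv.swap i j) k) * l k - l (τ k) * l k) =
      (l (τ i) - l (τ j)) * (l j - l i) := by
    rw [← Finset.sum_subset (Finset.subset_univ {i, j}), Finset.sum_pair hij.ne]
    · simp only [Equiv.Perm.mul_apply, Equiv.swap_apply_left, Equiv.swap_apply_right]
      ring
    · intro k _ hk
      simp only [Finset.mem_insert, Finset.mem_singleton, not_or] at hk
      rw [Equiv.Perm.mul_apply, Equiv.swap_apply_of_ne_of_ne hk.1 hk.2, sub_self]
  rw [h]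
  exact mul_pos (sub_pos.2 (hl hτ)) (sub_pos.2 (hl hij))

lemma lyapunov_permState (hP : P ∈ Matrix.unitaryGroup (Fin n) ℂ)
    (hs : IsDensity (permState P l 1)) (τ : Equiv.Perm (Fin n)) :
    lyapunov (permState P l τ) (permState P l 1) = ∑ k, l k * l k - ∑ k, l (τ k) * l k := by
  rw [lyapunov_eq_of_mem_isospectral hs (permState_mem_isospectral hP hs τ),
    reTr_permState_mul hP, reTr_permState_mul hP]
  simp

/-- A critical point other than the target is not a local minimum of `V`. -/
lemma exists_lyapunov_lt (hP : P ∈ Matrix.unitaryGroup (Fin n) ℂ) (hl : StrictMono l)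
    (hs : IsDensity (permState P l 1)) {τ : Equiv.Perm (Fin n)} (hτ : τ ≠ 1) {δ : ℝ} (hδ : 0 < δ) :
    ∃ y ∈ isospectral (permState P l 1), ‖y - permState P l τ‖ < δ ∧
      lyapunov y (permState P l 1) < lyapunov (permState P l τ) (permState P l 1) := by
  obtain ⟨i, j, hij, hτij⟩ : ∃ i j, i < j ∧ τ j < τ i := by
    by_contra! hcon
    exact hτ (strictMono_perm_eq_one
      (Monotone.strictMono_of_injective (monotone_iff_forall_lt.2 fun i j h => hcon i j h)
        τ.injective))
  obtain ⟨Q, hQ, hQs, hQd, hQc⟩ := exists_unitary_submatrix (Equiv.swap i j)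
  have hQstar : star Q = Q := by rw [hQs, hQd, Equiv.swap_inv]
  have hQQ : Q * Q = 1 := by
    have := unitary_mul_star hQ
    rwa [hQstar] at this
  set D : Mat n := Matrix.diagonal (fun k => (l (τ k) : ℂ)) with hD
  set L : Mat n := Matrix.diagonal (fun k => (l k : ℂ)) with hL
  have hDQ : Q * D * Q = Matrix.diagonal (fun k => (l ((τ * Equiv.swap i j) k) : ℂ)) := by
    have := hQc D
    rw [hQstar, hD, Matrix.submatrix_diagonal_equiv] at this
    rw [← this]; rfl
  -- This is `exp(iθQ)`, since `Q` is a self-adjoint involution. It moves continuously from the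
  -- identity to the transposition of an inverted pair, up to a phase.
  let W : ℝ → Mat n := fun θ => (Real.cos θ : ℂ) • 1 + (Complex.I * Real.sin θ) • Q
  have hWs : ∀ θ, star (W θ) = (Real.cos θ : ℂ) • 1 - (Complex.I * Real.sin θ) • Q := by
    intro θ
    simp only [W, star_add, star_smul, star_one, hQstar, RCLike.star_def, map_mul, Complex.conj_ofReal,
      Complex.conj_I]
    rw [neg_mul, neg_smul, sub_eq_add_neg]
  have hcs : ∀ θ : ℝ, (Real.cos θ : ℂ) * Real.cos θ + Real.sin θ * Real.sin θ = 1 := by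
    intro θ
    rw [← Complex.ofReal_mul, ← Complex.ofReal_mul, ← Complex.ofReal_add, ← pow_two, ← pow_two,
      Real.cos_sq_add_sin_sq, Complex.ofReal_one]
  have hII : ∀ z : ℂ, (Complex.I * z) * (Complex.I * z) = -(z * z) := fun z => by
    linear_combination z * z * Complex.I_mul_I
  have hWu : ∀ θ, W θ ∈ Matrix.unitaryGroup (Fin n) ℂ := by
    intro θ
    rw [Matrix.mem_unitaryGroup_iff, hWs]
    have h1 : W θ * ((Real.cos θ : ℂ) • 1 - (Complex.I * Real.sin θ) • Q) =
        ((Real.cos θ : ℂ) * Real.cos θ + Real.sin θ * Real.sin θ) • (1 : Mat n) := by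
      simp only [W, add_mul, mul_sub, smul_mul_smul_comm, hQQ, mul_one, one_mul, hII]
      module
    rw [h1, hcs, one_smul]
  -- The overlap interpolates with weights `cos²` and `sin²`; the cross term is traceless because
  -- `D` and `L` commute. So it increases strictly for every small `θ > 0`.
  have hWD : ∀ θ, reTr (W θ * D * star (W θ) * L) =
      (1 - Real.sin θ ^ 2) * reTr (D * L) + Real.sin θ ^ 2 * reTr (Q * D * Q * L) := by
    intro θ
    have h1 : W θ * D * star (W θ) * L = ((1 - Real.sin θ ^ 2 : ℝ) : ℂ) • (D * L) +
        ((Real.sin θ ^ 2 : ℝ) : ℂ) • (Q * D * Q * L) +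
        (Complex.I * (Real.sin θ * Real.cos θ)) • (Q * D * L - D * Q * L) := by
      rw [← Real.cos_sq', hWs]
      simp only [W, add_mul, mul_sub, sub_mul, smul_mul_assoc, mul_smul_comm,
        one_mul, mul_one, smul_smul, smul_sub, smul_add, hII]
      push_cast
      module
    have hDL : D * L = L * D := by
      rw [hD, hL, Matrix.diagonal_mul_diagonal, Matrix.diagonal_mul_diagonal]
      simp only [mul_comm]
    have h2 : (Q * D * L - D * Q * L).trace = 0 := by
      rw [Matrix.trace_sub, Matrix.trace_mul_cycle D Q L, mul_assoc Q D L,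
        Matrix.trace_mul_comm Q (D * L), hDL, sub_self]
    rw [h1, map_add, map_add, reTr_apply ((Complex.I * _) • _), Matrix.trace_smul, h2]
    simp only [reTr_apply, Matrix.trace_smul, smul_eq_mul, Complex.re_ofReal_mul, mul_zero,
      Complex.zero_re, add_zero]
  let y : ℝ → Mat n := fun θ => P * (W θ * D * star (W θ)) * star P
  have hy0 : y 0 = permState P l τ := by simp [y, W, permState, hD]
  have hycont : Continuous y := by
    have hWc : Continuous W := by fun_prop
    fun_prop
  have hyP : ∀ θ, y θ = (P * W θ * star P) * permState P l τ * star (P * W θ * star P) := by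
    intro θ
    rw [star_conj, permState, conj_mul_conj hP, conj_mul_conj hP]
  have hymem : ∀ θ, y θ ∈ isospectral (permState P l 1) := by
    intro θ
    rw [hyP]
    exact conj_mem_isospectral (mul_mem (mul_mem hP (hWu θ)) (star_mem_unitary hP))
      (permState_mem_isospectral hP hs τ)
  have hnear : ∀ᶠ θ in 𝓝[>] (0 : ℝ), ‖y θ - permState P l τ‖ < δ := by
    have h1 : Tendsto (fun θ => ‖y θ - permState P l τ‖) (𝓝 0) (𝓝 0) := by
      have := (hycont.sub (continuous_const (y := permState P l τ))).norm.tendsto 0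
      simpa [hy0] using this
    exact (h1.mono_left nhdsWithin_le_nhds).eventually_lt_const hδ
  have hpos : ∀ᶠ θ in 𝓝[>] (0 : ℝ), θ ∈ Ioo 0 Real.pi := Ioo_mem_nhdsGT Real.pi_pos
  obtain ⟨θ, hθ, hθπ⟩ := (hnear.and hpos).exists
  refine ⟨y θ, hymem θ, hθ, ?_⟩
  have hsin : 0 < Real.sin θ ^ 2 := pow_pos (Real.sin_pos_of_mem_Ioo hθπ) 2
  have hval : ∀ τ' : Equiv.Perm (Fin n),
      reTr (Matrix.diagonal (fun k => (l (τ' k) : ℂ)) * L) = ∑ k, l (τ' k) * l k := by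
    intro τ'
    have := reTr_permState_mul (l := l) hP τ' 1
    rwa [permState, permState, conj_mul_conj hP, reTr_conj hP] at this
  have hlt := sum_swap_lt hl hij hτij
  rw [lyapunov_eq_of_mem_isospectral hs (hymem θ),
    lyapunov_eq_of_mem_isospectral hs (permState_mem_isospectral hP hs τ)]
  refine sub_lt_sub_left ?_ _
  have e1 : reTr (y θ * permState P l 1) = reTr (W θ * D * star (W θ) * L) := by
    simp only [y, permState, Equiv.Perm.one_apply]
    rw [conj_mul_conj hP, reTr_conj hP]
  have e2 : reTr (permState P l τ * permState P l 1) = ∑ k, l (τ k) * l k :=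
    reTr_permState_mul hP τ 1
  rw [e1, e2, hWD, hDQ, hval, hval]
  nlinarith

end permState

/-! ### Criticality and commutation -/

lemma isCriticalPoint_of_isMax {s x : Mat n} (hs : IsDensity s) (hx : x ∈ isospectral s)
    (hmax : ∀ y ∈ isospectral s, lyapunov y s ≤ lyapunov x s) : IsCriticalPoint s x := by
  refine ⟨hx, fun γ hγ h0 hd => ?_⟩
  have heq : (fun t => lyapunov (γ t) s) = fun t => reTr (s * s) - reTr (γ t * s) :=
    funext fun t => lyapunov_eq_of_mem_isospectral hs (hγ t)
  have h1 : HasDerivAt (fun t => lyapunov (γ t) s) (-(reTr (deriv γ 0 * s))) 0 := by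
    rw [heq]
    exact (hasDerivAt_reTr (hd.hasDerivAt.mul_const s)).const_sub _
  have h2 : IsLocalMax (fun t => lyapunov (γ t) s) 0 :=
    Eventually.of_forall fun t => by simpa only [h0] using hmax _ (hγ t)
  rw [h2.hasDerivAt_eq_zero h1] at h1
  exact h1

/-- Test criticality on the conjugation of `x` by `exp(-itK)` with the Hermitian generator `K = i[x,
s]`: along it `V` has initial derivative `‖[x, s]‖²`. -/
lemma lie_eq_zero_of_isCriticalPoint {s x : Mat n} (hs : IsDensity s) (h : IsCriticalPoint s x) :
    ⁅x, s⁆ = 0 := by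
  have hxh : star x = x := (isHermitian_of_mem_isospectral h.1).eq
  have hsh : star s = s := hs.1.isHermitian.eq
  have hCs : star ⁅x, s⁆ = -⁅x, s⁆ := by
    rw [Ring.lie_def, star_sub, star_mul, star_mul, hxh, hsh, neg_sub]
  have hK : (Complex.I • ⁅x, s⁆).IsHermitian := by
    change star (Complex.I • ⁅x, s⁆) = _
    rw [star_smul, hCs]
    simp
  obtain ⟨U, hU, a, hUa⟩ := exists_eq_diagonal hK
  let γ : ℝ → Mat n := fun t => propagator U a t * x * propagator U a (-t)
  have hγ : ∀ t, γ t ∈ isospectral s := fun t => by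
    have := conj_mem_isospectral (propagator_mem_unitary (a := a) hU t) h.1
    rwa [star_propagator] at this
  have h0 : γ 0 = x := by simp [γ, propagator_zero hU]
  have hE := hasDerivAt_propagator (a := a) hU 0
  have hE' : HasDerivAt (fun t => propagator U a (-t))
      (-((-Complex.I) • (Complex.I • ⁅x, s⁆) * propagator U a (-0))) 0 := by
    have h1 := hasDerivAt_propagator (a := a) hU (-0)
    rw [← hUa] at h1
    exact (h1.scomp (0 : ℝ) (hasDerivAt_neg (0 : ℝ))).congr_deriv (neg_one_smul ℝ _)
  rw [← hUa] at hE
  have hd := (hE.mul_const x).fun_mul hE'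
  have hV := h.2 γ hγ h0 hd.differentiableAt
  have heq : (fun t => lyapunov (γ t) s) = fun t => reTr (s * s) - reTr (γ t * s) :=
    funext fun t => lyapunov_eq_of_mem_isospectral hs (hγ t)
  rw [heq] at hV
  have hV2 := (hasDerivAt_reTr (hd.mul_const s)).const_sub (reTr (s * s))
  have h3 := hV.unique hV2
  have hII : (-Complex.I) • Complex.I • ⁅x, s⁆ = ⁅x, s⁆ := by
    rw [smul_smul]; simp
  simp only [neg_zero, propagator_zero hU, mul_one, one_mul, hII] at h3
  have h4 : reTr ((⁅x, s⁆ * x + x * -⁅x, s⁆) * s) = -‖⁅x, s⁆‖ ^ 2 := by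
    have : (⁅x, s⁆ * x + x * -⁅x, s⁆) * s = ⁅x, s⁆ * (x * s) - x * (⁅x, s⁆ * s) := by
      noncomm_ring
    rw [this, map_sub, reTr_mul_comm x, mul_assoc, ← map_sub, ← mul_sub, ← Ring.lie_def,
      norm_sq_eq_reTr, hCs, neg_mul, map_neg, neg_neg]
  have h5 : ‖⁅x, s⁆‖ ^ 2 = 0 := by
    rw [h4] at h3
    linarith
  exact norm_eq_zero.1 (pow_eq_zero_iff two_ne_zero |>.1 h5)

/-- The test curves are differentiable only at `0`, so no tangent space is invoked. Constancy of the
traces of powers along the curve forces the velocity to have zero diagonal in the eigenbasis, and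
the derivative of the overlap with `s` sees only that diagonal. -/
lemma isCriticalPoint_permState {P : Mat n} {l : Fin n → ℝ}
    (hP : P ∈ Matrix.unitaryGroup (Fin n) ℂ) (hl : StrictMono l)
    (hs : IsDensity (permState P l 1)) (τ : Equiv.Perm (Fin n)) :
    IsCriticalPoint (permState P l 1) (permState P l τ) := by
  refine ⟨permState_mem_isospectral hP hs τ, fun γ hγ h0 hd => ?_⟩
  obtain ⟨g, hg⟩ : ∃ g, HasDerivAt γ g 0 := ⟨_, hd.hasDerivAt⟩
  set s := permState P l 1
  set D : Mat n := Matrix.diagonal (fun k => (l (τ k) : ℂ)) with hD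
  have hγ0 : γ 0 = P * D * star P := h0
  set G := star P * g * P with hG
  have hGγ : g = P * G * star P := (conj_conj_star hP _).symm
  -- The extra power `r` makes the induction go through, since `g` need not commute with `γ 0`. At
  -- `m = 0` the truncated `m - 1` is harmless, as the factor `m` vanishes.
  have hpow : ∀ m : ℕ, ∃ Dm : Mat n, HasDerivAt (fun t => γ t ^ m) Dm 0 ∧
      ∀ r : ℕ, (Dm * γ 0 ^ r).trace = m * (g * γ 0 ^ (m - 1 + r)).trace := by
    intro m
    induction m with
    | zero => exact ⟨0, (hasDerivAt_const (0 : ℝ) (1 : Mat n)).congr_of_eventuallyEq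
        (Eventually.of_forall fun t => pow_zero _), by simp⟩
    | succ k ih =>
      obtain ⟨Dk, hDk, hDkr⟩ := ih
      refine ⟨_, (hDk.fun_mul hg).congr_of_eventuallyEq
        (Eventually.of_forall fun t => pow_succ _ _), fun r => ?_⟩
      rw [add_mul, Matrix.trace_add, mul_assoc Dk, ← pow_succ', hDkr,
        Matrix.trace_mul_cycle, ← pow_add, Matrix.trace_mul_comm (γ 0 ^ _)]
      rcases k with _ | k
      · simp
      · rw [show k + 1 - 1 + (r + 1) = k + 1 + 1 - 1 + r by omega,
          show r + (k + 1) = k + 1 + 1 - 1 + r by omega]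
        push_cast
        ring
  have hzero : ∀ m : ℕ, ∑ k, G k k * (l (τ k) : ℂ) ^ m = 0 := by
    intro m
    obtain ⟨Dm, hDm, hDmr⟩ := hpow (m + 1)
    have h1 : HasDerivAt (fun t => (γ t ^ (m + 1)).trace) Dm.trace 0 :=
      hasDerivAt_trace hDm
    have h2 : (fun t => (γ t ^ (m + 1)).trace) = fun _ => (s ^ (m + 1)).trace :=
      funext fun t => trace_pow_eq_of_mem_isospectral hs (hγ t) _
    rw [h2] at h1
    have h3 := h1.unique (hasDerivAt_const _ _)
    have h4 := hDmr 0
    rw [pow_zero, mul_one, h3, add_zero, Nat.add_sub_cancel] at h4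
    have h5 := (mul_eq_zero.1 h4.symm).resolve_left (by exact_mod_cast Nat.succ_ne_zero m)
    have h6 : γ 0 ^ m = P * Matrix.diagonal (fun k => (l (τ k) : ℂ) ^ m) * star P := by
      rw [hγ0, conj_pow hP, hD, Matrix.diagonal_pow]
      rfl
    rw [hGγ, h6, conj_mul_conj hP, Matrix.trace_mul_comm, ← mul_assoc, unitary_star_mul hP,
      one_mul] at h5
    simpa [Matrix.trace, Matrix.mul_diagonal] using h5
  -- Vandermonde: the eigenvalues are distinct.
  have hGz := Matrix.eq_zero_of_forall_pow_sum_mul_pow_eq_zero (R := ℂ)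
    (f := fun k => (l (τ k) : ℂ)) (v := fun k => G k k)
    (Complex.ofReal_injective.comp (hl.injective.comp τ.injective)) (fun m => hzero m)
  have heq : (fun t => lyapunov (γ t) s) = fun t => reTr (s * s) - reTr (γ t * s) :=
    funext fun t => lyapunov_eq_of_mem_isospectral hs (hγ t)
  rw [heq]
  refine ((hasDerivAt_reTr (hg.mul_const s)).const_sub (reTr (s * s))).congr_deriv ?_
  rw [neg_eq_zero, hGγ]
  change reTr (P * G * star P * (P * Matrix.diagonal (fun k => (l k : ℂ)) * star P)) = 0
  rw [conj_mul_conj hP, reTr_conj hP, reTr_apply]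
  have hGk : ∀ k, G k k = 0 := fun k => congrFun hGz k
  simp [Matrix.trace, Matrix.mul_diagonal, hGk]

lemma isCriticalPoint_iff {P : Mat n} {l : Fin n → ℝ}
    (hP : P ∈ Matrix.unitaryGroup (Fin n) ℂ) (hl : StrictMono l)
    (hs : IsDensity (permState P l 1)) (x : Mat n) :
    IsCriticalPoint (permState P l 1) x ↔ ∃ τ, x = permState P l τ := by
  constructor
  · exact fun h => eq_permState_of_lie_eq_zero hP hl h.1 (lie_eq_zero_of_isCriticalPoint hs h)
  · rintro ⟨τ, rfl⟩
    exact isCriticalPoint_permState hP hl hs τ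

/-- The state with the eigenvalues in reverse order is the only global maximum of `V`. -/
lemma lyapunov_lt_permState_rev {P : Mat n} {l : Fin n → ℝ}
    (hP : P ∈ Matrix.unitaryGroup (Fin n) ℂ) (hl : StrictMono l)
    (hs : IsDensity (permState P l 1)) {x : Mat n} (hx : x ∈ isospectral (permState P l 1))
    (hne : x ≠ permState P l Fin.revPerm) :
    lyapunov x (permState P l 1) <
      lyapunov (permState P l Fin.revPerm) (permState P l 1) := by
  -- Any maximizer is critical, hence a rearrangement, and it must be order-reversing. Compactness
  -- supplies a maximizer, so the reversal is the only one.
  have key : ∀ y ∈ isospectral (permState P l 1),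
      (∀ z ∈ isospectral (permState P l 1),
        lyapunov z (permState P l 1) ≤ lyapunov y (permState P l 1)) →
      y = permState P l Fin.revPerm := by
    intro y hy hmax
    obtain ⟨τ, rfl⟩ := (isCriticalPoint_iff hP hl hs y).1 (isCriticalPoint_of_isMax hs hy hmax)
    suffices h : StrictMono (Fin.revPerm * τ : Equiv.Perm (Fin n)) by
      have h1 := strictMono_perm_eq_one h
      rw [mul_eq_one_iff_eq_inv] at h1
      rw [show τ = Fin.revPerm⁻¹ * (Fin.revPerm * τ) by group, strictMono_perm_eq_one h, mul_one]
      rfl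
    intro i j hij
    simp only [Equiv.Perm.mul_apply, Fin.revPerm_apply, Fin.rev_lt_rev]
    by_contra hcon
    have hlt : τ i < τ j := lt_of_le_of_ne (not_lt.1 hcon) (τ.injective.ne hij.ne)
    -- The inequality is applied to the swapped permutation, which has the inverted pair; swapping
    -- back recovers `τ`, so `τ` has the larger overlap and the smaller `V`.
    have h2 := sum_swap_lt (l := l) (τ := τ * Equiv.swap i j) hl hij (by simpa using hlt)
    rw [mul_assoc, Equiv.swap_mul_self, mul_one] at h2
    have h3 := hmax _ (permState_mem_isospectral hP hs (τ * Equiv.swap i j))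
    rw [lyapunov_permState hP hs, lyapunov_permState hP hs] at h3
    linarith
  have hcont : ContinuousOn (fun y => lyapunov y (permState P l 1))
      (isospectral (permState P l 1)) := by
    unfold lyapunov
    fun_prop
  obtain ⟨m, hm, hmax⟩ := (isCompact_isospectral hs).exists_isMaxOn ⟨x, hx⟩ hcont
  have hmr := key m hm fun z hz => hmax hz
  rw [← hmr] at hne ⊢
  refine lt_of_le_of_ne (hmax hx) fun heq => hne ?_
  rw [hmr]
  exact key x hx fun z hz => heq ▸ hmax hz

/-! ### Differential equations on a half-line -/

lemma eq_of_hasDerivWithinAt_zero {F : Type*} [NormedAddCommGroup F] [NormedSpace ℝ F]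
    {f : ℝ → F} (hf : ∀ t : ℝ, 0 ≤ t → HasDerivWithinAt f 0 (Ici 0) t) {t : ℝ} (ht : 0 ≤ t) :
    f t = f 0 :=
  constant_of_has_deriv_right_zero
    (fun x hx => (hf x hx.1).continuousWithinAt.mono Icc_subset_Ici_self)
    (fun x hx => (hf x hx.1).mono (Ici_subset_Ici.2 hx.1)) t ⟨ht, le_rfl⟩

/-- A bounded Lipschitz vector field has global forward solutions. -/
lemma exists_forward_solution {F : Type*} [NormedAddCommGroup F] [NormedSpace ℝ F]
    [CompleteSpace F] {v : F → F} {K : NNReal} (hK : LipschitzWith K v) {L : ℝ}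
    (hL : ∀ x, ‖v x‖ ≤ L) (x₀ : F) :
    ∃ α : ℝ → F, α 0 = x₀ ∧ ∀ t : ℝ, 0 ≤ t → HasDerivWithinAt α (v (α t)) (Ici 0) t := by
  have hloc : ∀ N : ℕ, ∃ α : ℝ → F, α 0 = x₀ ∧
      ∀ t ∈ Icc (0 : ℝ) N, HasDerivWithinAt α (v (α t)) (Icc (0 : ℝ) N) t := by
    intro N
    have h0 : (0 : ℝ) ∈ Icc (0 : ℝ) N := ⟨le_rfl, N.cast_nonneg⟩
    -- A solution of speed at most `L` stays within distance `L * N` up to time `N`.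
    have hpl : IsPicardLindelof (fun _ => v) (⟨0, h0⟩ : Icc (0 : ℝ) N) x₀
        (L.toNNReal * N) 0 L.toNNReal K := by
      refine ⟨fun _ _ => hK.lipschitzOnWith, fun _ _ => continuousOn_const,
        fun _ _ x _ => (hL x).trans (Real.le_coe_toNNReal L), ?_⟩
      simp
    exact hpl.exists_eq_forall_mem_Icc_hasDerivWithinAt₀
  choose β hβ0 hβ using hloc
  have hcont : ∀ N, ContinuousOn (β N) (Icc (0 : ℝ) N) := fun N t ht =>
    (hβ N t ht).continuousWithinAt
  have hright : ∀ (N : ℕ) (t : ℝ), t ∈ Ico (0 : ℝ) N →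
      HasDerivWithinAt (β N) (v (β N t)) (Ici t) t := fun N t ht =>
    (hβ N t ⟨ht.1, ht.2.le⟩).mono_of_mem_nhdsWithin
      (mem_of_superset (Icc_mem_nhdsGE ht.2) (Icc_subset_Icc_left ht.1))
  have huniq : ∀ M N : ℕ, M ≤ N → EqOn (β M) (β N) (Icc (0 : ℝ) M) := by
    intro M N hMN
    have hMN' : (M : ℝ) ≤ N := by exact_mod_cast hMN
    exact ODE_solution_unique (v := fun _ => v) (fun _ => hK) (hcont M) (hright M)
      ((hcont N).mono (Icc_subset_Icc_right hMN'))
      (fun t ht => hright N t ⟨ht.1, ht.2.trans_le hMN'⟩) (by rw [hβ0, hβ0])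
  have heq : ∀ (N : ℕ) (t : ℝ), t ∈ Icc (0 : ℝ) N → β ⌈t⌉₊ t = β N t := fun N t ht =>
    huniq _ N (Nat.ceil_le.2 ht.2) ⟨ht.1, Nat.le_ceil t⟩
  -- Solutions on `[0, N]` are glued, and uniqueness makes the choice of `N ≥ t` irrelevant.
  refine ⟨fun t => β ⌈t⌉₊ t, by simp [hβ0], fun t ht => ?_⟩
  obtain ⟨N, hN⟩ := exists_nat_gt t
  have h1 : Icc (0 : ℝ) N ∈ 𝓝[Ici 0] t := by
    rw [← Ici_inter_Iic]
    exact inter_mem_nhdsWithin _ (Iic_mem_nhds hN)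
  have h2 := (hβ N t ⟨ht, hN.le⟩).mono_of_mem_nhdsWithin h1
  simp only [heq N t ⟨ht, hN.le⟩]
  exact h2.congr_of_eventuallyEq (mem_of_superset h1 fun u hu => heq N u hu)
    (heq N t ⟨ht, hN.le⟩)

/-- A `C¹` vector field on a finite-dimensional space has forward solutions once it is multiplied
by a suitable cut-off that is one on a given ball. -/
lemma exists_forward_solution_cutoff {F : Type*} [NormedAddCommGroup F] [NormedSpace ℝ F]
    [FiniteDimensional ℝ F] {w : F → F} (hw : ContDiff ℝ 1 w) {R : ℝ} (hR : 0 < R) (x₀ : F) :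
    ∃ χ : F → ℝ, (∀ x, ‖x‖ ≤ R → χ x = 1) ∧ ∃ α : ℝ → F, α 0 = x₀ ∧
      ∀ t : ℝ, 0 ≤ t → HasDerivWithinAt α (χ (α t) • w (α t)) (Ici 0) t := by
  have : CompleteSpace F := FiniteDimensional.complete ℝ F
  let χ : ContDiffBump (0 : F) := ⟨R, R + 1, hR, by linarith⟩
  have hv : ContDiff ℝ 1 (fun x => χ x • w x) := χ.contDiff.smul hw
  have hsupp : HasCompactSupport (fun x => χ x • w x) := χ.hasCompactSupport.smul_right
  obtain ⟨K, hK⟩ := ContDiff.lipschitzWith_of_hasCompactSupport hsupp hv one_ne_zero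
  obtain ⟨L, hL⟩ := hsupp.exists_bound_of_continuous hv.continuous
  refine ⟨χ, fun x hx => χ.one_of_mem_closedBall (mem_closedBall_zero_iff.2 hx), ?_⟩
  exact exists_forward_solution hK hL x₀

/-! ### The von Neumann equation -/

section vonNeumann

variable {A y : ℝ → Mat n}

/-- The flow is conjugation by unitaries, seen here infinitesimally. `y` need not be Hermitian and
`A` need not be continuous in time; this lets the lemma apply to differences, adjoints and
polynomials of solutions. -/
lemma norm_eq_of_vonNeumann (hA : ∀ t, 0 ≤ t → (A t).IsHermitian)
    (hy : ∀ t : ℝ, 0 ≤ t → HasDerivWithinAt y ((-Complex.I) • ⁅A t, y t⁆) (Ici 0) t)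
    {t : ℝ} (ht : 0 ≤ t) : ‖y t‖ = ‖y 0‖ := by
  have key : ∀ t : ℝ, 0 ≤ t →
      HasDerivWithinAt (fun t => reTr (star (y t) * y t)) 0 (Ici 0) t := by
    intro t ht
    have h := hasDerivWithinAt_reTr ((hy t ht).star.fun_mul (hy t ht))
    refine h.congr_deriv ?_
    set z := y t
    set B := A t
    have hB : star B = B := (hA t ht).eq
    have h1 : reTr (Complex.I • (star z * B * z)) = 0 := by
      refine reTr_I_smul_of_isHermitian ?_
      change star (star z * B * z) = _
      simp [hB, mul_assoc]
    have h2 : reTr (Complex.I • (star z * (z * B))) = 0 := by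
      have : reTr (Complex.I • (star z * (z * B))) = reTr (Complex.I • (z * B * star z)) := by
        rw [← mul_smul_comm, reTr_mul_comm, smul_mul_assoc]
      rw [this]
      refine reTr_I_smul_of_isHermitian ?_
      change star (z * B * star z) = _
      simp [hB, mul_assoc]
    have h3 : reTr (star z * ((-Complex.I) • ⁅B, z⁆)) = 0 := by
      rw [mul_smul_comm, Ring.lie_def, mul_sub, neg_smul, smul_sub, map_neg, map_sub, h2,
        ← mul_assoc, h1]
      simp
    have h4 : star ((-Complex.I) • ⁅B, z⁆) * z = star (star z * ((-Complex.I) • ⁅B, z⁆)) := by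
      rw [star_mul, star_star]
    rw [map_add, h4, reTr_star, h3, add_zero]
  have h := eq_of_hasDerivWithinAt_zero key ht
  rw [← norm_sq_eq_reTr, ← norm_sq_eq_reTr] at h
  exact (sq_eq_sq₀ (norm_nonneg _) (norm_nonneg _)).1 h

lemma vonNeumann_sub {z : ℝ → Mat n}
    (hy : ∀ t : ℝ, 0 ≤ t → HasDerivWithinAt y ((-Complex.I) • ⁅A t, y t⁆) (Ici 0) t)
    (hz : ∀ t : ℝ, 0 ≤ t → HasDerivWithinAt z ((-Complex.I) • ⁅A t, z t⁆) (Ici 0) t)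
    {t : ℝ} (ht : 0 ≤ t) :
    HasDerivWithinAt (fun t => y t - z t) ((-Complex.I) • ⁅A t, y t - z t⁆) (Ici 0) t := by
  refine ((hy t ht).fun_sub (hz t ht)).congr_deriv ?_
  simp only [Ring.lie_def, mul_sub, sub_mul, smul_sub]
  abel

lemma vonNeumann_eq {z : ℝ → Mat n} (hA : ∀ t, 0 ≤ t → (A t).IsHermitian)
    (hy : ∀ t : ℝ, 0 ≤ t → HasDerivWithinAt y ((-Complex.I) • ⁅A t, y t⁆) (Ici 0) t)
    (hz : ∀ t : ℝ, 0 ≤ t → HasDerivWithinAt z ((-Complex.I) • ⁅A t, z t⁆) (Ici 0) t)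
    (h0 : y 0 = z 0) {t : ℝ} (ht : 0 ≤ t) : y t = z t := by
  have h := norm_eq_of_vonNeumann hA (fun t ht => vonNeumann_sub hy hz ht) ht
  rw [h0, sub_self, norm_zero, norm_eq_zero, sub_eq_zero] at h
  exact h

lemma vonNeumann_star (hA : ∀ t, 0 ≤ t → (A t).IsHermitian)
    (hy : ∀ t : ℝ, 0 ≤ t → HasDerivWithinAt y ((-Complex.I) • ⁅A t, y t⁆) (Ici 0) t)
    {t : ℝ} (ht : 0 ≤ t) :
    HasDerivWithinAt (fun t => star (y t)) ((-Complex.I) • ⁅A t, star (y t)⁆) (Ici 0) t := by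
  refine (hy t ht).star.congr_deriv ?_
  have hB : star (A t) = A t := (hA t ht).eq
  rw [star_smul, Ring.lie_def, Ring.lie_def, star_sub, star_mul, star_mul, hB]
  simp only [star_neg, RCLike.star_def, Complex.conj_I, neg_neg]
  rw [neg_smul, ← smul_neg, neg_sub]

/-- Commutation with `A t` is a derivation, so powers of a solution solve the same equation, and
then so do their linear combinations. -/
lemma vonNeumann_aeval
    (hy : ∀ t : ℝ, 0 ≤ t → HasDerivWithinAt y ((-Complex.I) • ⁅A t, y t⁆) (Ici 0) t)
    (p : Polynomial ℂ) {t : ℝ} (ht : 0 ≤ t) :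
    HasDerivWithinAt (fun t => Polynomial.aeval (y t) p)
      ((-Complex.I) • ⁅A t, Polynomial.aeval (y t) p⁆) (Ici 0) t := by
  have hpow : ∀ m : ℕ, HasDerivWithinAt (fun t => y t ^ m)
      ((-Complex.I) • ⁅A t, y t ^ m⁆) (Ici 0) t := by
    intro m
    induction m with
    | zero =>
      refine ((hasDerivWithinAt_const t (Ici 0) (1 : Mat n)).congr_of_eventuallyEq
        (Eventually.of_forall fun t => pow_zero _) (pow_zero _)).congr_deriv ?_
      simp [Ring.lie_def]
    | succ k ih =>
      refine ((ih.fun_mul (hy t ht)).congr_of_eventuallyEq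
        (Eventually.of_forall fun t => pow_succ _ _) (pow_succ _ _)).congr_deriv ?_
      rw [smul_mul_assoc, mul_smul_comm, ← smul_add, pow_succ]
      simp only [Ring.lie_def]
      congr 1
      noncomm_ring
  induction p using Polynomial.induction_on' with
  | add p q hp hq =>
    refine ((hp.fun_add hq).congr_of_eventuallyEq
      (Eventually.of_forall fun t => map_add _ _ _) (map_add _ _ _)).congr_deriv ?_
    simp only [map_add, Ring.lie_def, mul_add, add_mul, smul_sub, smul_add]
    abel
  | monomial m c =>
    have he : ∀ t, Polynomial.aeval (y t) (Polynomial.monomial m c) = c • y t ^ m := fun t => by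
      rw [Polynomial.aeval_monomial, Algebra.smul_def]
    refine (((hpow m).const_smul c).congr_of_eventuallyEq
      (Eventually.of_forall he) (he t)).congr_deriv ?_
    rw [he, smul_comm]
    congr 1
    simp only [Ring.lie_def, mul_smul_comm, smul_mul_assoc, smul_sub]

/-- The von Neumann equation preserves the set of states isospectral to a generic state. -/
lemma mem_isospectral_of_vonNeumann {s : Mat n} (hs : IsDensity s) (hg : IsGeneric s)
    (hA : ∀ t, 0 ≤ t → (A t).IsHermitian)
    (hy : ∀ t : ℝ, 0 ≤ t → HasDerivWithinAt y ((-Complex.I) • ⁅A t, y t⁆) (Ici 0) t)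
    (h0 : y 0 ∈ isospectral s) {t : ℝ} (ht : 0 ≤ t) : y t ∈ isospectral s := by
  have hherm : (y t).IsHermitian :=
    (vonNeumann_eq hA (fun t ht => vonNeumann_star hA hy ht) hy
      (isHermitian_of_mem_isospectral h0).eq ht)
  obtain ⟨W, hW, hyW⟩ := (mem_isospectral_iff hs).1 h0
  -- The characteristic polynomial at the fixed time `t`, evaluated along the solution, has constant
  -- norm. It vanishes at time `t` by Cayley-Hamilton, hence at time `0`, hence on `s`.
  have hq : Polynomial.aeval s (y t).charpoly = 0 := by
    have h1 := norm_eq_of_vonNeumann hA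
      (y := fun u => Polynomial.aeval (y u) (y t).charpoly)
      (fun u hu => vonNeumann_aeval hy (y t).charpoly hu) ht
    rw [Matrix.aeval_self_charpoly, norm_zero] at h1
    have h2 : Polynomial.aeval (y 0) (y t).charpoly = 0 := norm_eq_zero.1 h1.symm
    have h3 : Polynomial.aeval (y 0) (y t).charpoly =
        W * Polynomial.aeval s (y t).charpoly * star W := by
      rw [hyW, Polynomial.aeval_eq_sum_range, Polynomial.aeval_eq_sum_range, Finset.mul_sum,
        Finset.sum_mul]
      refine Finset.sum_congr rfl fun i _ => ?_
      rw [conj_pow hW, mul_smul_comm, smul_mul_assoc]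
    have h4 := conj_star_conj hW (Polynomial.aeval s (y t).charpoly)
    rw [← h3, h2] at h4
    simpa using h4.symm
  have hfin : (spectrum ℂ s).Finite := Matrix.finite_spectrum s
  have hroot : ∀ (B : Mat n), Polynomial.aeval s B.charpoly = 0 → ∀ μ ∈ spectrum ℂ s,
      B.charpoly.eval μ = 0 := by
    intro B hB μ hμ
    have : Nontrivial (Mat n) := by
      by_contra hcon
      rw [not_nontrivial_iff_subsingleton] at hcon
      exact hμ (isUnit_of_subsingleton (algebraMap ℂ (Mat n) μ - s))
    have h1 := spectrum.subset_polynomial_aeval s B.charpoly ⟨μ, hμ, rfl⟩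
    rw [hB, spectrum.zero_eq] at h1
    exact h1
  have hdeg : ∀ B : Mat n, B.charpoly.degree = (hfin.toFinset.card : WithBot ℕ) := by
    intro B
    rw [Matrix.charpoly_degree_eq_dim, Fintype.card_fin, ← ncard_eq_toFinset_card _ hfin]
    rw [IsGeneric] at hg
    rw [hg]
  -- Both are monic of degree `n` and vanish at the `n` distinct eigenvalues of `s`.
  have hcp : (y t).charpoly = s.charpoly := by
    refine Polynomial.eq_of_degree_le_of_eval_finset_eq hfin.toFinset (hdeg _).le
      ((hdeg _).trans (hdeg _).symm) ?_ ?_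
    · rw [(Matrix.charpoly_monic _).leadingCoeff, (Matrix.charpoly_monic _).leadingCoeff]
    · intro μ hμ
      rw [hroot _ hq μ (hfin.mem_toFinset.1 hμ),
        hroot _ (Matrix.aeval_self_charpoly s) μ (hfin.mem_toFinset.1 hμ)]
  exact (mem_isospectral_iff hs).2
    (exists_unitary_conj_of_charpoly_eq hherm hs.1.isHermitian hcp)

end vonNeumann

/-! ### Existence and basic properties of trajectories -/

section trajectories

variable {H₀ H₁ : Mat n}

lemma isHermitian_add_real_smul (hH₀ : H₀.IsHermitian) (hH₁ : H₁.IsHermitian) (r : ℝ) :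
    (H₀ + (r : ℂ) • H₁).IsHermitian := by
  refine hH₀.add ?_
  change star ((r : ℂ) • H₁) = _
  rw [star_smul, Matrix.star_eq_conjTranspose, hH₁.eq]
  simp

/-- The vector field is polynomial, hence not globally Lipschitz, so it is cut off. Both components
of the cut-off system are still von Neumann equations with Hermitian generators; norms are conserved
and the cut-off is never active. -/
lemma exists_isTrajectory (hH₀ : H₀.IsHermitian) (hH₁ : H₁.IsHermitian) (x₀ s₀ : Mat n) :
    ∃ ρ σ : ℝ → Mat n, IsTrajectory H₀ H₁ ρ σ ∧ ρ 0 = x₀ ∧ σ 0 = s₀ := by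
  let w : Mat n × Mat n → Mat n × Mat n := fun z =>
    ((-Complex.I) • ⁅H₀ + (feedback H₁ z.1 z.2 : ℂ) • H₁, z.1⁆, (-Complex.I) • ⁅H₀, z.2⁆)
  have hfb : ContDiff ℝ 1 (fun z : Mat n × Mat n => (feedback H₁ z.1 z.2 : ℂ)) := by
    have h1 : ContDiff ℝ 1
        (fun z : Mat n × Mat n => ⁅(-Complex.I) • H₁, z.1⁆ * z.2) := by
      simp only [Ring.lie_def]
      fun_prop
    exact Complex.ofRealCLM.contDiff.comp
      ((LinearMap.toContinuousLinearMap reTr).contDiff.comp h1)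
  have hw : ContDiff ℝ 1 w := by
    simp only [w, Ring.lie_def]
    fun_prop
  obtain ⟨χ, hχ1, α, hα0, hα⟩ := exists_forward_solution_cutoff hw
    (R := ‖(x₀, s₀)‖ + 1) (by positivity) (x₀, s₀)
  have hsm : ∀ (r : ℝ) (B z : Mat n),
      r • ((-Complex.I) • ⁅B, z⁆) = (-Complex.I) • ⁅(r : ℂ) • B, z⁆ := by
    intro r B z
    rw [smul_comm]
    congr 1
    simp only [Ring.lie_def, smul_mul_assoc, mul_smul_comm, smul_sub, Complex.coe_smul]
  have h1 : ∀ t : ℝ, 0 ≤ t → HasDerivWithinAt (fun t => (α t).1)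
      ((-Complex.I) • ⁅((χ (α t) : ℝ) : ℂ) •
        (H₀ + (feedback H₁ (α t).1 (α t).2 : ℂ) • H₁), (α t).1⁆) (Ici 0) t := by
    intro t ht
    rw [← hsm]
    exact (ContinuousLinearMap.fst ℝ (Mat n) (Mat n)).hasFDerivAt.comp_hasDerivWithinAt t (hα t ht)
  have h2 : ∀ t : ℝ, 0 ≤ t → HasDerivWithinAt (fun t => (α t).2)
      ((-Complex.I) • ⁅((χ (α t) : ℝ) : ℂ) • H₀, (α t).2⁆) (Ici 0) t := by
    intro t ht
    rw [← hsm]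
    exact (ContinuousLinearMap.snd ℝ (Mat n) (Mat n)).hasFDerivAt.comp_hasDerivWithinAt t (hα t ht)
  have hreal : ∀ (r : ℝ) {B : Mat n}, B.IsHermitian → ((r : ℂ) • B).IsHermitian := by
    intro r B hB
    simpa using isHermitian_add_real_smul (H₀ := 0) Matrix.isHermitian_zero hB r
  have hχ : ∀ t : ℝ, 0 ≤ t → χ (α t) = 1 := by
    intro t ht
    have e1 := norm_eq_of_vonNeumann
      (fun t _ => hreal _ (isHermitian_add_real_smul hH₀ hH₁ _)) h1 ht
    have e2 := norm_eq_of_vonNeumann (fun t _ => hreal _ hH₀) h2 ht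
    apply hχ1
    rw [Prod.norm_def, e1, e2, ← Prod.norm_def, hα0]
    linarith
  refine ⟨fun t => (α t).1, fun t => (α t).2, ⟨fun t ht => ?_, fun t ht => ?_⟩,
    congrArg Prod.fst hα0, congrArg Prod.snd hα0⟩
  · have := h1 t ht
    rwa [hχ t ht, Complex.ofReal_one, one_smul] at this
  · have := h2 t ht
    rwa [hχ t ht, Complex.ofReal_one, one_smul] at this

lemma IsFreeTrajectory.eq {c c' : ℝ → Mat n} (hH₀ : H₀.IsHermitian)
    (hc : IsFreeTrajectory H₀ c) (hc' : IsFreeTrajectory H₀ c') (h0 : c 0 = c' 0) {t : ℝ}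
    (ht : 0 ≤ t) : c t = c' t :=
  vonNeumann_eq (A := fun _ => H₀) (fun _ _ => hH₀) hc hc' h0 ht

lemma exists_isAdmissible (hH₀ : H₀.IsHermitian) (hH₁ : H₁.IsHermitian) {ρd : ℝ → Mat n}
    (hρd : IsFreeTrajectory H₀ ρd) {x : Mat n} (hx : x ∈ isospectral (ρd 0)) :
    ∃ ρ, IsAdmissible H₀ H₁ ρd ρ ∧ ρ 0 = x := by
  obtain ⟨ρ, σ, h, hρ, hσ⟩ := exists_isTrajectory hH₀ hH₁ x (ρd 0)
  have he : ∀ t, 0 ≤ t → σ t = ρd t := fun t ht => h.2.eq hH₀ hρd hσ ht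
  refine ⟨ρ, ⟨⟨fun t ht => ?_, hρd⟩, hρ ▸ hx⟩, hρ⟩
  rw [← he t ht]
  exact h.1 t ht

lemma isFreeTrajectory_propagator {U : Mat n} {a : Fin n → ℝ}
    (hU : U ∈ Matrix.unitaryGroup (Fin n) ℂ)
    (hH₀ : H₀ = U * Matrix.diagonal (fun k => (a k : ℂ)) * star U) (x : Mat n) :
    IsFreeTrajectory H₀ (fun t => propagator U a t * x * star (propagator U a t)) := by
  intro t _
  have h1 : HasDerivWithinAt (propagator U a) ((-Complex.I) • H₀ * propagator U a t) (Ici 0) t := by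
    rw [hH₀]
    exact (hasDerivAt_propagator hU t).hasDerivWithinAt
  have hH : star H₀ = H₀ := by
    rw [hH₀, star_conj, Matrix.star_eq_conjTranspose (Matrix.diagonal _),
      Matrix.diagonal_conjTranspose]
    congr 3
    ext k
    simp
  refine ((h1.mul_const x).fun_mul h1.star).congr_deriv ?_
  rw [star_mul, star_smul, hH, Ring.lie_def]
  simp only [star_neg, RCLike.star_def, Complex.conj_I, neg_neg, smul_mul_assoc, mul_smul_comm,
    neg_smul, smul_sub, mul_assoc, neg_mul]
  abel

end trajectories

/-! ### Asymptotic analysis on a half-line -/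

/-- Barbalat's lemma: the nonnegative Lipschitz derivative of a bounded function tends to zero. -/
lemma tendsto_zero_of_hasDerivWithinAt {g h : ℝ → ℝ} {B C : ℝ}
    (hg : ∀ t : ℝ, 0 ≤ t → HasDerivWithinAt g (h t) (Ici 0) t)
    (hlip : ∀ t u : ℝ, 0 ≤ t → t ≤ u → h t - C * (u - t) ≤ h u)
    (hpos : ∀ t, 0 ≤ t → 0 ≤ h t) (hB : ∀ t, 0 ≤ t → g t ≤ B) (hC : 0 ≤ C) :
    Tendsto h atTop (𝓝 0) := by
  have hmvt : ∀ t u : ℝ, 0 ≤ t → t < u → ∃ ξ ∈ Ioo t u, h ξ = (g u - g t) / (u - t) := by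
    intro t u ht htu
    refine exists_hasDerivAt_eq_slope g h htu (fun x hx => ?_) (fun x hx => ?_)
    · exact ((hg x (ht.trans hx.1)).continuousWithinAt).mono (fun z hz => ht.trans hz.1)
    · exact (hg x (ht.trans hx.1.le)).hasDerivAt (Ici_mem_nhds (ht.trans_lt hx.1))
  have hmono : ∀ t u : ℝ, 0 ≤ t → t ≤ u → g t ≤ g u := by
    intro t u ht htu
    rcases htu.eq_or_lt with rfl | hlt
    · exact le_rfl
    · obtain ⟨ξ, hξ, he⟩ := hmvt t u ht hlt
      have h1 := hpos ξ (ht.trans hξ.1.le)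
      rw [he, le_div_iff₀ (sub_pos.2 hlt)] at h1
      linarith
  have hlim : ∃ l, Tendsto g atTop (𝓝 l) := by
    have hm : Monotone (fun t => g (max t 0)) := fun t u htu =>
      hmono _ _ (le_max_right _ _) (max_le_max_right _ htu)
    refine ⟨_, (tendsto_atTop_ciSup hm ⟨B, ?_⟩).congr' ?_⟩
    · rintro _ ⟨t, rfl⟩
      exact hB _ (le_max_right _ _)
    · filter_upwards [eventually_ge_atTop 0] with t ht
      rw [max_eq_left ht]
  obtain ⟨l, hl⟩ := hlim
  rw [Metric.tendsto_atTop]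
  intro ε hε
  set δ := ε / (2 * (C + 1)) with hδ
  have hδpos : 0 < δ := by positivity
  have hCδ : C * δ ≤ ε / 2 := by
    rw [hδ, ← mul_div_assoc, div_le_iff₀ (by positivity)]
    nlinarith
  obtain ⟨T, hT⟩ := (Metric.tendsto_atTop.1 hl) (δ * ε / 8) (by positivity)
  refine ⟨max T 0, fun t ht => ?_⟩
  have ht0 : 0 ≤ t := (le_max_right _ _).trans ht
  have htT : T ≤ t := (le_max_left _ _).trans ht
  -- Somewhere in `[t, t + δ]` the derivative equals the slope, at most `ε / 4`; since it drops by
  -- at most `C * δ ≤ ε / 2` on the way there, `h t ≤ 3ε / 4`.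
  obtain ⟨ξ, hξ, he⟩ := hmvt t (t + δ) ht0 (by linarith)
  have h1 := abs_lt.1 (hT t htT)
  have h2 := abs_lt.1 (hT (t + δ) (by linarith))
  have h3 := hlip t ξ ht0 hξ.1.le
  have h4 : h ξ ≤ ε / 4 := by
    rw [he, add_sub_cancel_left, div_le_iff₀ hδpos]
    linarith [h1.1, h2.2]
  have h5 : C * (ξ - t) ≤ C * δ := mul_le_mul_of_nonneg_left (by linarith [hξ.2]) hC
  rw [Real.dist_eq, sub_zero, abs_of_nonneg (hpos t ht0)]
  linarith

/-- A continuous curve all of whose limits along ultrafilters lie in a finite set converges. -/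
lemma exists_tendsto_of_ultrafilter {X : Type*} [TopologicalSpace X] [T2Space X] {x : ℝ → X}
    (hx : ContinuousOn x (Ici 0)) {S : Set X} (hS : S.Finite)
    (h : ∀ 𝒰 : Ultrafilter ℝ, (𝒰 : Filter ℝ) ≤ atTop → ∃ y ∈ S, Tendsto x 𝒰 (𝓝 y)) :
    ∃ y ∈ S, Tendsto x atTop (𝓝 y) := by
  obtain ⟨O, hO, hdisj⟩ := hS.t2_separation
  -- The tail lies in a finite disjoint union of open sets and is connected, so it stays in one of
  -- them.
  have hev : ∀ᶠ t in atTop, x t ∈ ⋃ y ∈ S, O y := by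
    refine mem_iff_ultrafilter.2 fun 𝒰 h𝒰 => ?_
    obtain ⟨y, hy, hxy⟩ := h 𝒰 h𝒰
    exact (hxy.eventually ((hO y).2.mem_nhds (hO y).1)).mono fun t ht => mem_biUnion hy ht
  obtain ⟨T, hT⟩ := eventually_atTop.1 (hev.and (eventually_ge_atTop 0))
  obtain ⟨y₀, hy₀, hTy⟩ := mem_iUnion₂.1 (hT T le_rfl).1
  have hconn : IsPreconnected (x '' Ici T) :=
    isPreconnected_Ici.image x (hx.mono (Ici_subset_Ici.2 (hT T le_rfl).2))
  have hsub : x '' Ici T ⊆ O y₀ := by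
    refine hconn.subset_left_of_subset_union (v := ⋃ y ∈ S \ {y₀}, O y) (hO y₀).2
      (isOpen_biUnion fun y _ => (hO y).2) ?_ ?_ ⟨x T, ⟨T, self_mem_Ici, rfl⟩, hTy⟩
    · rw [disjoint_iUnion₂_right]
      exact fun y hy => hdisj hy₀ hy.1 (fun e => hy.2 e.symm)
    · rintro _ ⟨t, ht, rfl⟩
      obtain ⟨y, hy, hty⟩ := mem_iUnion₂.1 (hT t ht).1
      rcases eq_or_ne y y₀ with rfl | hne
      · exact Or.inl hty
      · exact Or.inr (mem_biUnion (show y ∈ S \ {y₀} from ⟨hy, hne⟩) hty)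
  refine ⟨y₀, hy₀, tendsto_iff_ultrafilter _ _ _ |>.2 fun 𝒰 h𝒰 => ?_⟩
  obtain ⟨y, hy, hxy⟩ := h 𝒰 h𝒰
  rcases eq_or_ne y y₀ with rfl | hne
  · exact hxy
  · exfalso
    have e1 := hxy.eventually ((hO y).2.mem_nhds (hO y).1)
    have e2 := h𝒰 (Ici_mem_atTop T)
    obtain ⟨t, ht1, ht2⟩ := (e1.and e2).exists
    exact (hdisj hy hy₀ hne).le_bot ⟨ht1, hsub ⟨t, ht2, rfl⟩⟩

/-- The coefficients of an exponential sum that vanishes on a half-line vanish, frequency by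
frequency. -/
lemma sum_filter_eq_zero_of_exp_sum_eq_zero {ι : Type*} [Fintype ι] (w : ι → ℝ) (c : ι → ℂ)
    (h : ∀ s : ℝ, 0 ≤ s → ∑ p, c p * Complex.exp (Complex.I * w p * s) = 0) (v : ℝ) :
    ∑ p with w p = v, c p = 0 := by
  classical
  -- On nonnegative times the exponentials are characters of an additive monoid, so Dedekind's
  -- independence of characters applies.
  let e : ℝ → (Multiplicative NNReal →* ℂ) := fun v =>
    { toFun := fun s => Complex.exp (Complex.I * v * ((Multiplicative.toAdd s : NNReal) : ℝ))
      map_one' := by simp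
      map_mul' := fun s t => by
        rw [← Complex.exp_add, toAdd_mul]
        push_cast
        ring_nf }
  have hinj : Function.Injective e := by
    intro v v' hvv
    by_contra hne
    have hd : 0 < |v - v'| := abs_pos.2 (sub_ne_zero.2 hne)
    -- At time `π / |v - v'|` the quotient of the two characters is `-1`.
    have h1 : Complex.exp (Complex.I * v * (Real.pi / |v - v'| : ℝ)) =
        Complex.exp (Complex.I * v' * (Real.pi / |v - v'| : ℝ)) :=
      DFunLike.congr_fun hvv
        (Multiplicative.ofAdd (⟨Real.pi / |v - v'|, by positivity⟩ : NNReal))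
    have h2 : Complex.exp (Complex.I * ((v - v') * (Real.pi / |v - v'|) : ℝ)) = 1 := by
      rw [show Complex.I * ((v - v') * (Real.pi / |v - v'|) : ℝ) =
        Complex.I * v * (Real.pi / |v - v'| : ℝ) - Complex.I * v' * (Real.pi / |v - v'| : ℝ) by
          push_cast; ring, Complex.exp_sub, h1, div_self (Complex.exp_ne_zero _)]
    have h3 := congrArg Complex.re h2
    rw [mul_comm, Complex.exp_ofReal_mul_I_re, Complex.one_re] at h3
    have h4 : Real.cos ((v - v') * (Real.pi / |v - v'|)) = -1 := by
      rw [← Real.cos_abs, abs_mul, abs_div, abs_abs, abs_of_pos Real.pi_pos,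
        mul_div_cancel₀ _ hd.ne', Real.cos_pi]
    linarith
  have hli := (linearIndependent_monoidHom (Multiplicative NNReal) ℂ).comp e hinj
  have hsum : ∑ u ∈ Finset.univ.image w,
      (∑ p with w p = u, c p) • ((fun f : Multiplicative NNReal →* ℂ => (f : _ → ℂ)) ∘ e) u = 0 := by
    funext s
    have h1 := h ((Multiplicative.toAdd s : NNReal) : ℝ) (NNReal.coe_nonneg _)
    rw [Finset.sum_apply, Pi.zero_apply, ← h1, ← Finset.sum_fiberwise_of_maps_to
      (fun p _ => Finset.mem_image_of_mem w (Finset.mem_univ p))]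
    refine Finset.sum_congr rfl fun u _ => ?_
    rw [Pi.smul_apply, smul_eq_mul, Finset.sum_mul]
    refine Finset.sum_congr rfl fun p hp => ?_
    rw [← (Finset.mem_filter.1 hp).2]
    rfl
  by_cases hv : v ∈ Finset.univ.image w
  · exact linearIndependent_iff'.1 hli _ _ hsum v hv
  · refine Finset.sum_eq_zero fun p hp => ?_
    exact absurd (Finset.mem_image.2 ⟨p, Finset.mem_univ p, (Finset.mem_filter.1 hp).2⟩) hv

/-! ### The feedback -/

lemma feedback_eq_reTr (H x s : Mat n) : feedback H x s = reTr (⁅(-Complex.I) • H, x⁆ * s) := rfl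

lemma trace_lie_mul (H x s : Mat n) :
    (⁅(-Complex.I) • H, x⁆ * s).trace = -Complex.I * (H * ⁅x, s⁆).trace := by
  rw [Ring.lie_def, Ring.lie_def, sub_mul, mul_sub, Matrix.trace_sub, Matrix.trace_sub,
    mul_assoc x, Matrix.trace_mul_comm x, smul_mul_assoc, smul_mul_assoc, smul_mul_assoc,
    smul_mul_assoc, Matrix.trace_smul, Matrix.trace_smul, mul_assoc, mul_assoc, smul_eq_mul,
    smul_eq_mul]
  ring

/-- The trace on the right is purely imaginary. This replaces a real part by a complex trace, whose
exponential expansion can be compared frequency by frequency. -/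
lemma feedback_eq_zero_iff {H x s : Mat n} (hH : H.IsHermitian) (hx : x.IsHermitian)
    (hs : s.IsHermitian) : feedback H x s = 0 ↔ (H * ⁅x, s⁆).trace = 0 := by
  have h1 : star (H * ⁅x, s⁆).trace = -(H * ⁅x, s⁆).trace := by
    rw [← Matrix.trace_conjTranspose, Matrix.conjTranspose_mul, hH.eq, Ring.lie_def,
      Matrix.conjTranspose_sub, Matrix.conjTranspose_mul, Matrix.conjTranspose_mul, hx.eq, hs.eq,
      Matrix.trace_mul_comm, ← Matrix.trace_neg, ← mul_neg, neg_sub]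
  have h2 : (H * ⁅x, s⁆).trace.re = 0 := by
    have := congrArg Complex.re h1
    simp only [RCLike.star_def, Complex.conj_re, Complex.neg_re] at this
    linarith
  rw [feedback, trace_lie_mul, Complex.ext_iff, h2]
  simp

lemma feedback_eq_zero_of_lie_eq_zero {H x s : Mat n} (h : ⁅x, s⁆ = 0) : feedback H x s = 0 := by
  rw [feedback, trace_lie_mul, h]
  simp

lemma feedback_conj {W : Mat n} (hW : W ∈ Matrix.unitaryGroup (Fin n) ℂ) (H x s : Mat n) :
    feedback (star W * H * W) x s = feedback H (W * x * star W) (W * s * star W) := by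
  rw [feedback_eq_reTr, feedback_eq_reTr]
  have h1 : (-Complex.I) • H = W * ((-Complex.I) • (star W * H * W)) * star W := by
    rw [mul_smul_comm, smul_mul_assoc, conj_conj_star hW]
  rw [h1, conj_lie_conj hW, conj_mul_conj hW, reTr_conj hW]

lemma trace_conj_diagonal_mul {U : Mat n} (ε : Fin n → ℂ) (H C : Mat n) :
    (star (U * Matrix.diagonal ε * star U) * H * (U * Matrix.diagonal ε * star U) * C).trace =
      ∑ p : Fin n × Fin n, star (ε p.1) * ε p.2 *
        ((star U * H * U) p.1 p.2 * (star U * C * U) p.2 p.1) := by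
  have h1 : star (U * Matrix.diagonal ε * star U) * H * (U * Matrix.diagonal ε * star U) * C =
      U * (Matrix.diagonal (star ε) * (star U * H * U) * Matrix.diagonal ε * star U * C) := by
    rw [star_conj, Matrix.star_eq_conjTranspose (Matrix.diagonal _),
      Matrix.diagonal_conjTranspose]
    simp only [mul_assoc]
  rw [h1, Matrix.trace_mul_comm, mul_assoc _ (star U) C, mul_assoc _ (star U * C) U, Matrix.trace,
    Fintype.sum_prod_type]
  refine Finset.sum_congr rfl fun k _ => ?_
  rw [Matrix.diag_apply, Matrix.mul_apply]
  refine Finset.sum_congr rfl fun l _ => ?_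
  rw [Matrix.mul_diagonal, Matrix.diagonal_mul, Pi.star_apply]
  ring

/-! ### Convergence of trajectories -/

section convergence

variable {H₀ H₁ : Mat n} {U : Mat n} {a : Fin n → ℝ} {ρd ρ : ℝ → Mat n}

lemma IsFreeTrajectory.eq_propagator (hU : U ∈ Matrix.unitaryGroup (Fin n) ℂ)
    (hH₀ : H₀.IsHermitian) (hd : H₀ = U * Matrix.diagonal (fun k => (a k : ℂ)) * star U)
    (hρd : IsFreeTrajectory H₀ ρd) {t : ℝ} (ht : 0 ≤ t) :
    ρd t = propagator U a t * ρd 0 * star (propagator U a t) :=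
  hρd.eq hH₀ (isFreeTrajectory_propagator hU hd (ρd 0)) (by simp [propagator_zero hU]) ht

lemma IsAdmissible.mem_isospectral (hH₀ : H₀.IsHermitian) (hH₁ : H₁.IsHermitian)
    (hdens : IsDensity (ρd 0)) (hgen : IsGeneric (ρd 0)) (h : IsAdmissible H₀ H₁ ρd ρ) {t : ℝ}
    (ht : 0 ≤ t) : ρ t ∈ isospectral (ρd 0) :=
  mem_isospectral_of_vonNeumann hdens hgen (fun _ _ => isHermitian_add_real_smul hH₀ hH₁ _)
    h.1.1 h.2 ht

lemma IsFreeTrajectory.mem_isospectral (hH₀ : H₀.IsHermitian) (hdens : IsDensity (ρd 0))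
    (hgen : IsGeneric (ρd 0)) (h : IsFreeTrajectory H₀ ρd) {t : ℝ} (ht : 0 ≤ t) :
    ρd t ∈ isospectral (ρd 0) :=
  mem_isospectral_of_vonNeumann (A := fun _ => H₀) hdens hgen (fun _ _ => hH₀) h ⟨hdens, rfl⟩ ht

/-- The drift contributes the commutator of `-i H₀` with `ρ ρd`, which is traceless; the control
contributes `f` times the trace defining `f`. -/
lemma IsTrajectory.hasDerivWithinAt_reTr_mul (h : IsTrajectory H₀ H₁ ρ ρd) {t : ℝ} (ht : 0 ≤ t) :
    HasDerivWithinAt (fun t => reTr (ρ t * ρd t)) (feedback H₁ (ρ t) (ρd t) ^ 2) (Ici 0) t := by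
  refine (hasDerivWithinAt_reTr ((h.1 t ht).fun_mul (h.2 t ht))).congr_deriv ?_
  set f := feedback H₁ (ρ t) (ρd t) with hf
  have e : (-Complex.I) • ⁅H₀ + (f : ℂ) • H₁, ρ t⁆ * ρd t + ρ t * (-Complex.I) • ⁅H₀, ρd t⁆ =
      f • (⁅(-Complex.I) • H₁, ρ t⁆ * ρd t) +
        (((-Complex.I) • H₀) * (ρ t * ρd t) - (ρ t * ρd t) * ((-Complex.I) • H₀)) := by
    rw [← Complex.coe_smul f]
    simp only [Ring.lie_def, add_mul, mul_add, sub_mul, mul_sub, smul_mul_assoc, mul_smul_comm,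
      smul_sub, smul_add, mul_assoc]
    rw [smul_comm (f : ℂ) (-Complex.I), smul_comm (f : ℂ) (-Complex.I)]
    abel
  rw [e, map_add, map_sub, reTr_mul_comm ((-Complex.I) • H₀), sub_self, add_zero, map_smul,
    ← feedback_eq_reTr, ← hf, smul_eq_mul, pow_two]

lemma IsAdmissible.lyapunov_eq (hH₀ : H₀.IsHermitian) (hH₁ : H₁.IsHermitian)
    (hdens : IsDensity (ρd 0)) (hgen : IsGeneric (ρd 0)) (h : IsAdmissible H₀ H₁ ρd ρ) {t : ℝ}
    (ht : 0 ≤ t) :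
    lyapunov (ρ t) (ρd t) = reTr (ρd 0 * ρd 0) - reTr (ρ t * ρd t) := by
  have h1 := h.mem_isospectral hH₀ hH₁ hdens hgen ht
  have h2 := h.1.2.mem_isospectral hH₀ hdens hgen ht
  rw [lyapunov_eq_of_mem_isospectral h2.1 ⟨h1.1, h1.2.trans h2.2.symm⟩, ← pow_two (ρd t),
    ← pow_two (ρd 0), reTr_apply (ρd t ^ 2), trace_pow_eq_of_mem_isospectral hdens h2,
    ← reTr_apply]

/-- The Lyapunov function does not increase along trajectories. -/
lemma IsAdmissible.lyapunov_le (hH₀ : H₀.IsHermitian) (hH₁ : H₁.IsHermitian)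
    (hdens : IsDensity (ρd 0)) (hgen : IsGeneric (ρd 0)) (h : IsAdmissible H₀ H₁ ρd ρ) {t : ℝ}
    (ht : 0 ≤ t) : lyapunov (ρ t) (ρd t) ≤ lyapunov (ρ 0) (ρd 0) := by
  rw [h.lyapunov_eq hH₀ hH₁ hdens hgen ht, h.lyapunov_eq hH₀ hH₁ hdens hgen le_rfl]
  have hmono : MonotoneOn (fun t => reTr (ρ t * ρd t)) (Ici 0) := by
    refine monotoneOn_of_hasDerivWithinAt_nonneg (convex_Ici 0)
      (fun t ht => (h.1.hasDerivWithinAt_reTr_mul ht).continuousWithinAt)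
      (fun t ht => (h.1.hasDerivWithinAt_reTr_mul (interior_subset ht)).mono interior_subset)
      (fun t _ => sq_nonneg _)
  have := hmono self_mem_Ici (mem_Ici.2 ht) ht
  simp only at this
  linarith

lemma continuous_feedback {X : Type*} [TopologicalSpace X] {G x s : X → Mat n}
    (hG : Continuous G) (hx : Continuous x) (hs : Continuous s) :
    Continuous (fun z => feedback (G z) (x z) (s z)) := by
  simp only [feedback_eq_reTr, Ring.lie_def]
  fun_prop

/-- The feedback tends to zero along trajectories. -/
lemma IsAdmissible.tendsto_feedback (hH₀ : H₀.IsHermitian) (hH₁ : H₁.IsHermitian)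
    (hdens : IsDensity (ρd 0)) (hgen : IsGeneric (ρd 0)) (h : IsAdmissible H₀ H₁ ρd ρ) :
    Tendsto (fun t => feedback H₁ (ρ t) (ρd t)) atTop (𝓝 0) := by
  -- The time derivative of `f²` as a continuous function of the pair of states; its bound on the
  -- compact state space is the Lipschitz constant for Barbalat's lemma.
  let Φ : Mat n × Mat n → ℝ := fun z => 2 * feedback H₁ z.1 z.2 *
    (reTr (⁅(-Complex.I) • H₁, (-Complex.I) • ⁅H₀ + (feedback H₁ z.1 z.2 : ℂ) • H₁, z.1⁆⁆ * z.2) +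
      reTr (⁅(-Complex.I) • H₁, z.1⁆ * ((-Complex.I) • ⁅H₀, z.2⁆)))
  have hΦ : Continuous Φ := by
    have hf : Continuous fun z : Mat n × Mat n => feedback H₁ z.1 z.2 :=
      continuous_feedback continuous_const continuous_fst continuous_snd
    have hf' : Continuous fun z : Mat n × Mat n => (feedback H₁ z.1 z.2 : ℂ) :=
      Complex.continuous_ofReal.comp hf
    simp only [Φ, Ring.lie_def]
    fun_prop
  obtain ⟨C, hC⟩ := ((isCompact_isospectral hdens).prod
    (isCompact_isospectral hdens)).exists_bound_of_continuousOn hΦ.continuousOn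
  have hmem : ∀ t, 0 ≤ t → (ρ t, ρd t) ∈ isospectral (ρd 0) ×ˢ isospectral (ρd 0) := fun t ht =>
    ⟨h.mem_isospectral hH₀ hH₁ hdens hgen ht, h.1.2.mem_isospectral hH₀ hdens hgen ht⟩
  have hder : ∀ t : ℝ, 0 ≤ t → HasDerivWithinAt (fun t => feedback H₁ (ρ t) (ρd t) ^ 2)
      (Φ (ρ t, ρd t)) (Ici 0) t := by
    intro t ht
    have e1 : HasDerivWithinAt (fun t => ⁅(-Complex.I) • H₁, ρ t⁆)
        ⁅(-Complex.I) • H₁, (-Complex.I) • ⁅H₀ + (feedback H₁ (ρ t) (ρd t) : ℂ) • H₁, ρ t⁆⁆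
        (Ici 0) t := by
      simp only [Ring.lie_def ((-Complex.I) • H₁)]
      exact ((h.1.1 t ht).const_mul _).fun_sub ((h.1.1 t ht).mul_const _)
    have e2 := hasDerivWithinAt_reTr (e1.fun_mul (h.1.2 t ht))
    refine (e2.fun_pow 2).congr_deriv ?_
    rw [map_add]
    simp [Φ, feedback_eq_reTr]
  have hlip : ∀ t u : ℝ, 0 ≤ t → t ≤ u →
      feedback H₁ (ρ t) (ρd t) ^ 2 - C * (u - t) ≤ feedback H₁ (ρ u) (ρd u) ^ 2 := by
    intro t u ht htu
    have := (convex_Ici (0 : ℝ)).norm_image_sub_le_of_norm_hasDerivWithin_le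
      (fun z hz => hder z hz) (fun z hz => hC _ (hmem z hz)) (mem_Ici.2 ht)
      (mem_Ici.2 (ht.trans htu))
    rw [Real.norm_eq_abs, Real.norm_eq_abs, abs_of_nonneg (sub_nonneg.2 htu)] at this
    linarith [(abs_le.1 this).1]
  have hC0 : 0 ≤ C := (norm_nonneg _).trans (hC _ (hmem 0 le_rfl))
  have hsq := tendsto_zero_of_hasDerivWithinAt (B := reTr (ρd 0 * ρd 0))
    (fun t ht => h.1.hasDerivWithinAt_reTr_mul ht) hlip (fun t _ => sq_nonneg _)
    (fun t ht => by
      have e1 := h.lyapunov_eq hH₀ hH₁ hdens hgen ht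
      have e2 : 0 ≤ lyapunov (ρ t) (ρd t) := by unfold lyapunov; positivity
      linarith) hC0
  rw [tendsto_zero_iff_abs_tendsto_zero]
  have := (Real.continuous_sqrt.tendsto 0).comp hsq
  rw [Real.sqrt_zero] at this
  exact this.congr fun t => Real.sqrt_sq_eq_abs _

/-- The trajectory in the interaction picture. -/
noncomputable def interaction (U : Mat n) (a : Fin n → ℝ) (ρ : ℝ → Mat n) (t : ℝ) : Mat n :=
  star (propagator U a t) * ρ t * propagator U a t

lemma conj_interaction (hU : U ∈ Matrix.unitaryGroup (Fin n) ℂ) (t : ℝ) :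
    propagator U a t * interaction U a ρ t * star (propagator U a t) = ρ t :=
  conj_conj_star (propagator_mem_unitary hU t) _

lemma interaction_mem_isospectral (hU : U ∈ Matrix.unitaryGroup (Fin n) ℂ) {s : Mat n} {t : ℝ}
    (h : ρ t ∈ isospectral s) : interaction U a ρ t ∈ isospectral s := by
  have := conj_mem_isospectral (star_mem_unitary (propagator_mem_unitary (a := a) hU t)) h
  rwa [star_star] at this

lemma IsTrajectory.hasDerivWithinAt_interaction (hU : U ∈ Matrix.unitaryGroup (Fin n) ℂ)
    (hd : H₀ = U * Matrix.diagonal (fun k => (a k : ℂ)) * star U)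
    (h : IsTrajectory H₀ H₁ ρ ρd) {t : ℝ} (ht : 0 ≤ t) :
    HasDerivWithinAt (interaction U a ρ)
      (feedback H₁ (ρ t) (ρd t) •
        (star (propagator U a t) * ((-Complex.I) • ⁅H₁, ρ t⁆) * propagator U a t)) (Ici 0) t := by
  have h1 : HasDerivWithinAt (propagator U a) ((-Complex.I) • H₀ * propagator U a t) (Ici 0) t := by
    rw [hd]
    exact (hasDerivAt_propagator hU t).hasDerivWithinAt
  have hH : star H₀ = H₀ := by
    rw [hd, star_conj, Matrix.star_eq_conjTranspose (Matrix.diagonal _),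
      Matrix.diagonal_conjTranspose]
    congr 3
    ext k
    simp
  refine ((h1.star.fun_mul (h.1 t ht)).fun_mul h1).congr_deriv ?_
  rw [star_mul, star_smul, hH, ← Complex.coe_smul]
  simp only [star_neg, RCLike.star_def, Complex.conj_I, neg_neg, smul_mul_assoc, mul_smul_comm,
    neg_smul, smul_sub, smul_add, mul_assoc, neg_mul, mul_neg, Ring.lie_def, mul_sub, sub_mul,
    mul_add, add_mul, smul_neg]
  rw [smul_comm Complex.I, smul_comm Complex.I]
  abel

/-- The interaction picture is asymptotically constant over bounded times. -/
lemma IsAdmissible.tendsto_interaction_sub (hH₀ : H₀.IsHermitian) (hH₁ : H₁.IsHermitian)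
    (hdens : IsDensity (ρd 0)) (hgen : IsGeneric (ρd 0))
    (hU : U ∈ Matrix.unitaryGroup (Fin n) ℂ)
    (hd : H₀ = U * Matrix.diagonal (fun k => (a k : ℂ)) * star U)
    (h : IsAdmissible H₀ H₁ ρd ρ) {s : ℝ} (hs : 0 ≤ s) :
    Tendsto (fun t => interaction U a ρ (t + s) - interaction U a ρ t) atTop (𝓝 0) := by
  have hc : Continuous fun z : Mat n => (-Complex.I) • ⁅H₁, z⁆ := by
    simp only [Ring.lie_def]
    fun_prop
  obtain ⟨C, hC⟩ := (isCompact_isospectral hdens).exists_bound_of_continuousOn hc.continuousOn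
  have hC0 : 0 ≤ C := (norm_nonneg _).trans (hC _ h.2)
  refine Metric.tendsto_atTop.2 fun ε hε => ?_
  -- Once `|f|` is below this constant, the displacement over time `s` is at most `ε C s / ((C +
  -- 1)(s + 1)) < ε`.
  have hη : 0 < ε / ((C + 1) * (s + 1)) := by positivity
  obtain ⟨T, hT⟩ := (Metric.tendsto_atTop.1
    (h.tendsto_feedback hH₀ hH₁ hdens hgen)) _ hη
  refine ⟨max T 0, fun t ht => ?_⟩
  have ht0 : 0 ≤ t := (le_max_right _ _).trans ht
  have htT : T ≤ t := (le_max_left _ _).trans ht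
  have hb := (convex_Ici t).norm_image_sub_le_of_norm_hasDerivWithin_le
    (f := interaction U a ρ) (C := ε / ((C + 1) * (s + 1)) * C)
    (fun z hz => (h.1.hasDerivWithinAt_interaction hU hd (ht0.trans hz)).mono
      (Ici_subset_Ici.2 ht0))
    (fun z hz => by
      have hz0 : 0 ≤ z := ht0.trans hz
      have e1 := hT z (htT.trans hz)
      rw [dist_zero_right] at e1
      have e2 := norm_conj (star_mem_unitary (propagator_mem_unitary (a := a) hU z))
        ((-Complex.I) • ⁅H₁, ρ z⁆)
      rw [star_star] at e2
      rw [norm_smul, e2]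
      exact mul_le_mul e1.le (hC _ (h.mem_isospectral hH₀ hH₁ hdens hgen hz0)) (norm_nonneg _)
        hη.le)
    self_mem_Ici (mem_Ici.2 (le_add_of_nonneg_right hs))
  rw [dist_zero_right]
  refine hb.trans_lt ?_
  rw [add_sub_cancel_left, Real.norm_of_nonneg hs, div_mul_eq_mul_div, div_mul_eq_mul_div,
    div_lt_iff₀ (by positivity), mul_assoc]
  refine mul_lt_mul_of_pos_left ?_ hε
  nlinarith

end convergence

/-! ### Limit points in the interaction picture -/

section limits

variable {H₀ H₁ : Mat n} {U : Mat n} {a : Fin n → ℝ} {ρd ρ : ℝ → Mat n}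

/-- If the feedback of a state vanishes along all free evolutions with shifted phases, it vanishes
along the free evolution itself. -/
lemma trace_eq_zero_of_shifted_trace_eq_zero
    (hω : ∀ k l p q : Fin n, k ≠ l → p ≠ q → a l - a k = a q - a p → k = p ∧ l = q)
    {ε : Fin n → ℂ} (hε : ∀ k, ‖ε k‖ = 1) {H C : Mat n}
    (h : ∀ s : ℝ, 0 ≤ s →
      (star ((U * Matrix.diagonal ε * star U) * propagator U a s) * H *
        ((U * Matrix.diagonal ε * star U) * propagator U a s) * C).trace = 0)
    (hU : U ∈ Matrix.unitaryGroup (Fin n) ℂ) (s : ℝ) :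
    (star (propagator U a s) * H * propagator U a s * C).trace = 0 := by
  set b : Fin n × Fin n → ℂ := fun p => (star U * H * U) p.1 p.2 * (star U * C * U) p.2 p.1 with hb
  set w : Fin n × Fin n → ℝ := fun p => a p.1 - a p.2 with hw
  have hphase : ∀ (s : ℝ) (p : Fin n × Fin n),
      star (Complex.exp (-(Complex.I * a p.1 * s))) * Complex.exp (-(Complex.I * a p.2 * s)) =
        Complex.exp (Complex.I * w p * s) := by
    intro s p
    rw [RCLike.star_def, ← Complex.exp_conj, ← Complex.exp_add]
    congr 1
    simp [hw]
    ring
  have hεε : ∀ k, star (ε k) * ε k = 1 := fun k => by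
    rw [RCLike.star_def, mul_comm, Complex.mul_conj, Complex.normSq_eq_norm_sq, hε]
    simp
  have h1 : ∀ s : ℝ, 0 ≤ s →
      ∑ p, (star (ε p.1) * ε p.2 * b p) * Complex.exp (Complex.I * w p * s) = 0 := by
    intro s hs
    have e := h s hs
    rw [propagator, conj_mul_conj hU, Matrix.diagonal_mul_diagonal, trace_conj_diagonal_mul] at e
    rw [← e]
    refine Finset.sum_congr rfl fun p _ => ?_
    rw [← hphase, star_mul']
    ring
  -- An off-diagonal frequency is attained by one pair only, and it is nonzero, since otherwise it
  -- would coincide with that of the reversed pair. So its coefficient vanishes alone, and the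
  -- unimodular factor in front drops out.
  have hoff : ∀ p : Fin n × Fin n, p.1 ≠ p.2 → b p = 0 := by
    intro p hp
    have e := sum_filter_eq_zero_of_exp_sum_eq_zero w _ h1 (w p)
    have hf : (Finset.univ.filter fun q => w q = w p) = {p} := by
      ext q
      simp only [Finset.mem_filter, Finset.mem_univ, true_and, Finset.mem_singleton]
      refine ⟨fun hq => ?_, fun hq => by rw [hq]⟩
      rcases eq_or_ne q.1 q.2 with hq' | hq'
      · exfalso
        have h0 : a p.1 - a p.2 = 0 := by
          have : w q = 0 := by simp [hw, hq']
          rw [← this, hq]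
        have := hω p.1 p.2 p.2 p.1 hp hp.symm (by linarith)
        exact hp this.1
      · have := hω q.2 q.1 p.2 p.1 hq'.symm hp.symm hq
        exact Prod.ext this.2 this.1
    rw [hf, Finset.sum_singleton] at e
    have hne : star (ε p.1) * ε p.2 ≠ 0 := by
      have hk : ∀ k, ε k ≠ 0 := fun k hk => by simpa [hk] using hε k
      exact mul_ne_zero (star_ne_zero.2 (hk _)) (hk _)
    exact (mul_eq_zero.1 e).resolve_left hne
  -- The zero frequency collects the diagonal pairs, where the phase shifts cancel; what remains is
  -- the unshifted trace.
  have hzero := sum_filter_eq_zero_of_exp_sum_eq_zero w _ h1 0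
  rw [propagator, trace_conj_diagonal_mul]
  rw [Finset.sum_filter] at hzero
  rw [← hzero]
  refine Finset.sum_congr rfl fun p _ => ?_
  rw [hphase]
  change Complex.exp (Complex.I * w p * s) * b p = _
  rcases eq_or_ne p.1 p.2 with hp | hp
  · have hw0 : w p = 0 := by simp [hw, hp]
    rw [if_pos hw0, hp, hεε, hw0]
    simp
  · rw [hoff p hp]
    simp

/-- Limit points, in the interaction picture, of trajectories of a regular system commute with
the initial state of the target. -/
lemma IsAdmissible.lie_limit_eq_zero (hH₀ : H₀.IsHermitian) (hH₁ : H₁.IsHermitian)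
    (hdens : IsDensity (ρd 0)) (hgen : IsGeneric (ρd 0))
    (hU : U ∈ Matrix.unitaryGroup (Fin n) ℂ)
    (hd : H₀ = U * Matrix.diagonal (fun k => (a k : ℂ)) * star U)
    (hω : ∀ k l p q : Fin n, k ≠ l → p ≠ q → a l - a k = a q - a p → k = p ∧ l = q)
    (hreg : IsRegular (laSalleSet H₀ H₁ ρd))
    (h : IsAdmissible H₀ H₁ ρd ρ) {𝒰 : Ultrafilter ℝ} (h𝒰 : (𝒰 : Filter ℝ) ≤ atTop) {y : Mat n}
    (hy : y ∈ isospectral (ρd 0)) (hlim : Tendsto (interaction U a ρ) 𝒰 (𝓝 y)) :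
    ⁅y, ρd 0⁆ = 0 := by
  have hyh := isHermitian_of_mem_isospectral hy
  have hsh := hdens.1.isHermitian
  have hconjH : ∀ W : Mat n, (star W * H₁ * W).IsHermitian := fun W => by
    change star (star W * H₁ * W) = _
    rw [star_mul, star_mul, star_star, Matrix.star_eq_conjTranspose H₁, hH₁.eq, mul_assoc]
  have hfb : ∀ t : ℝ, 0 ≤ t → feedback H₁ (ρ t) (ρd t) =
      feedback (star (propagator U a t) * H₁ * propagator U a t) (interaction U a ρ t) (ρd 0) := by
    intro t ht
    rw [feedback_conj (propagator_mem_unitary hU t), conj_interaction hU,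
      ← h.1.2.eq_propagator hU hH₀ hd ht]
  -- the phases converge along the ultrafilter
  let ph : ℝ → Fin n → Circle := fun t k => Circle.exp (-(a k * t))
  obtain ⟨e, -, he⟩ := isCompact_univ.ultrafilter_le_nhds (𝒰.map ph) (by simp)
  have hprop : ∀ t, propagator U a t =
      U * Matrix.diagonal (fun k => (ph t k : ℂ)) * star U := by
    intro t
    rw [propagator]
    congr 3
    ext k
    simp only [ph, Circle.coe_exp]
    push_cast
    ring_nf
  have hE : Tendsto (propagator U a) 𝒰
      (𝓝 (U * Matrix.diagonal (fun k => (e k : ℂ)) * star U)) := by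
    have hc : Continuous fun z : Fin n → Circle =>
        U * Matrix.diagonal (fun k => (z k : ℂ)) * star U := by
      have : Continuous fun z : Fin n → Circle => Matrix.diagonal (fun k => (z k : ℂ)) :=
        Continuous.matrix_diagonal (by fun_prop)
      fun_prop
    exact ((hc.tendsto e).comp he).congr fun t => (hprop t).symm
  set Einf := U * Matrix.diagonal (fun k => (e k : ℂ)) * star U with hEinf
  -- Follow the feedback at time `t + s` along the ultrafilter: the propagator splits into its limit
  -- times the propagator at `s`, the interaction picture still tends to `y`, and the feedback tends
  -- to zero.
  have hshift : ∀ s : ℝ, 0 ≤ s →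
      feedback (star (Einf * propagator U a s) * H₁ * (Einf * propagator U a s)) y (ρd 0) = 0 := by
    intro s hs
    have hx : Tendsto (fun t => interaction U a ρ (t + s)) 𝒰 (𝓝 y) := by
      have e1 := (h.tendsto_interaction_sub hH₀ hH₁ hdens hgen hU hd hs).mono_left h𝒰
      have e2 := e1.add hlim
      rw [zero_add] at e2
      exact e2.congr fun t => sub_add_cancel _ _
    have hc : Continuous fun z : Mat n × Mat n =>
        feedback (star (z.1 * propagator U a s) * H₁ * (z.1 * propagator U a s)) z.2 (ρd 0) :=
      continuous_feedback (by fun_prop) continuous_snd continuous_const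
    have h1 := (hc.tendsto (Einf, y)).comp (hE.prodMk_nhds hx)
    have h2 : Tendsto (fun t => feedback H₁ (ρ (t + s)) (ρd (t + s))) 𝒰 (𝓝 0) :=
      ((h.tendsto_feedback hH₀ hH₁ hdens hgen).comp
        (tendsto_atTop_add_const_right _ s tendsto_id)).mono_left h𝒰
    refine tendsto_nhds_unique h1 (h2.congr' ?_)
    filter_upwards [h𝒰 (Ici_mem_atTop 0)] with t ht
    rw [hfb _ (add_nonneg ht hs), propagator_add hU]
    rfl
  have hfree : ∀ s : ℝ,
      feedback (star (propagator U a s) * H₁ * propagator U a s) y (ρd 0) = 0 := by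
    intro s
    rw [feedback_eq_zero_iff (hconjH _) hyh hsh]
    refine trace_eq_zero_of_shifted_trace_eq_zero hω (fun k => Circle.norm_coe (e k)) ?_ hU s
    intro s hs
    exact (feedback_eq_zero_iff (hconjH _) hyh hsh).1 (hshift s hs)
  -- With vanishing feedback the free evolution of `y` solves the closed loop, and `V` is constant
  -- because both states undergo the same unitary conjugation.
  refine hreg (y, ρd 0) ⟨hy, ⟨0, self_mem_Ici, rfl⟩,
    fun t => propagator U a t * y * star (propagator U a t), ρd, ⟨fun t ht => ?_, h.1.2⟩,
    by simp [propagator_zero hU], rfl, fun t ht => ?_⟩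
  · rw [h.1.2.eq_propagator hU hH₀ hd ht, ← feedback_conj (propagator_mem_unitary hU t), hfree,
      Complex.ofReal_zero, zero_smul, add_zero]
    exact isFreeTrajectory_propagator hU hd y t ht
  · refine (hasDerivWithinAt_const t (Ici 0) (lyapunov y (ρd 0))).congr_of_mem ?_ ht
    intro u hu
    simp only [lyapunov]
    rw [h.1.2.eq_propagator hU hH₀ hd hu, norm_conj_sub_conj (propagator_mem_unitary hU u)]

/-- Every trajectory of a regular system converges, in the interaction picture, to a critical
point. -/
lemma IsAdmissible.exists_tendsto_interaction (hH₀ : H₀.IsHermitian) (hH₁ : H₁.IsHermitian)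
    (hU : U ∈ Matrix.unitaryGroup (Fin n) ℂ)
    (hd : H₀ = U * Matrix.diagonal (fun k => (a k : ℂ)) * star U)
    (hω : ∀ k l p q : Fin n, k ≠ l → p ≠ q → a l - a k = a q - a p → k = p ∧ l = q)
    (hdens : IsDensity (ρd 0)) (hgen : IsGeneric (ρd 0))
    (hreg : IsRegular (laSalleSet H₀ H₁ ρd)) {P : Mat n} {l : Fin n → ℝ}
    (hP : P ∈ Matrix.unitaryGroup (Fin n) ℂ) (hl : StrictMono l) (hs : ρd 0 = permState P l 1)
    (h : IsAdmissible H₀ H₁ ρd ρ) :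
    ∃ τ, Tendsto (interaction U a ρ) atTop (𝓝 (permState P l τ)) := by
  have hmem : ∀ t, 0 ≤ t → interaction U a ρ t ∈ isospectral (ρd 0) := fun t ht =>
    interaction_mem_isospectral hU (h.mem_isospectral hH₀ hH₁ hdens hgen ht)
  have hcont : ContinuousOn (interaction U a ρ) (Ici 0) := fun t ht =>
    (h.1.hasDerivWithinAt_interaction hU hd ht).continuousWithinAt
  obtain ⟨_, ⟨τ, rfl⟩, hτ⟩ := exists_tendsto_of_ultrafilter hcont
    (S := range (permState P l)) (finite_range _) (fun 𝒰 h𝒰 => by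
      have hU' : ∀ᶠ t in (𝒰 : Filter ℝ), interaction U a ρ t ∈ isospectral (ρd 0) := by
        filter_upwards [h𝒰 (Ici_mem_atTop 0)] with t ht using hmem t ht
      obtain ⟨y, hy, hlim⟩ := (isCompact_isospectral hdens).ultrafilter_le_nhds
        (𝒰.map (interaction U a ρ)) (tendsto_principal.2 hU')
      have hlie := h.lie_limit_eq_zero hH₀ hH₁ hdens hgen hU hd hω hreg h𝒰 hy hlim
      rw [hs] at hy hlie
      obtain ⟨τ, rfl⟩ := eq_permState_of_lie_eq_zero hP hl hy hlie
      exact ⟨_, mem_range_self τ, hlim⟩)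
  exact ⟨τ, hτ⟩

end limits

/-! ### Stability of the critical trajectories -/

section stability

variable {H₀ H₁ : Mat n} {U : Mat n} {a : Fin n → ℝ} {ρd ρ : ℝ → Mat n}

/-- The free evolution of the state `x`. -/
noncomputable def freeEvolution (U : Mat n) (a : Fin n → ℝ) (x : Mat n) (t : ℝ) : Mat n :=
  propagator U a t * x * star (propagator U a t)

lemma freeEvolution_zero (hU : U ∈ Matrix.unitaryGroup (Fin n) ℂ) (x : Mat n) :
    freeEvolution U a x 0 = x := by
  simp [freeEvolution, propagator_zero hU]

lemma norm_sub_freeEvolution (hU : U ∈ Matrix.unitaryGroup (Fin n) ℂ) (x : Mat n) (t : ℝ) :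
    ‖ρ t - freeEvolution U a x t‖ = ‖interaction U a ρ t - x‖ := by
  have h := norm_conj_sub_conj (propagator_mem_unitary (a := a) hU t) (interaction U a ρ t) x
  rwa [conj_interaction hU] at h

lemma isAdmissible_freeEvolution (hU : U ∈ Matrix.unitaryGroup (Fin n) ℂ) (hH₀ : H₀.IsHermitian)
    (hd : H₀ = U * Matrix.diagonal (fun k => (a k : ℂ)) * star U)
    (hρd : IsFreeTrajectory H₀ ρd) {x : Mat n} (hx : x ∈ isospectral (ρd 0))
    (hlie : ⁅x, ρd 0⁆ = 0) : IsAdmissible H₀ H₁ ρd (freeEvolution U a x) := by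
  refine ⟨⟨fun t ht => ?_, hρd⟩, by rwa [freeEvolution_zero hU]⟩
  have h : ⁅freeEvolution U a x t, ρd t⁆ = 0 := by
    rw [hρd.eq_propagator hU hH₀ hd ht, freeEvolution,
      conj_lie_conj (propagator_mem_unitary hU t), hlie]
    simp
  rw [feedback_eq_zero_of_lie_eq_zero h, Complex.ofReal_zero, zero_smul, add_zero]
  exact isFreeTrajectory_propagator hU hd x t ht

lemma isCriticalPoint_freeEvolution (hU : U ∈ Matrix.unitaryGroup (Fin n) ℂ) {P : Mat n}
    {l : Fin n → ℝ} (hP : P ∈ Matrix.unitaryGroup (Fin n) ℂ) (hl : StrictMono l)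
    (hs : IsDensity (permState P l 1)) (τ : Equiv.Perm (Fin n)) (t : ℝ) :
    IsCriticalPoint (freeEvolution U a (permState P l 1) t)
      (freeEvolution U a (permState P l τ) t) := by
  have hE := propagator_mem_unitary (a := a) hU t
  have h : ∀ τ, freeEvolution U a (permState P l τ) t = permState (propagator U a t * P) l τ := by
    intro τ
    simp only [freeEvolution, permState, star_mul, mul_assoc]
  have hs' := isDensity_conj hE hs
  rw [h, h]
  refine isCriticalPoint_permState (mul_mem hE hP) hl ?_ τ
  rw [← h]
  exact hs'

/-- `V` at the limit of a trajectory is at most `V` at its initial state. -/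
lemma IsAdmissible.lyapunov_limit_le (hH₀ : H₀.IsHermitian) (hH₁ : H₁.IsHermitian)
    (hU : U ∈ Matrix.unitaryGroup (Fin n) ℂ)
    (hd : H₀ = U * Matrix.diagonal (fun k => (a k : ℂ)) * star U)
    (hdens : IsDensity (ρd 0)) (hgen : IsGeneric (ρd 0)) (h : IsAdmissible H₀ H₁ ρd ρ) {y : Mat n}
    (hlim : Tendsto (interaction U a ρ) atTop (𝓝 y)) :
    lyapunov y (ρd 0) ≤ lyapunov (ρ 0) (ρd 0) := by
  have hc : Continuous fun z : Mat n => lyapunov z (ρd 0) := by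
    unfold lyapunov
    fun_prop
  refine le_of_tendsto ((hc.tendsto y).comp hlim) ?_
  filter_upwards [eventually_ge_atTop 0] with t ht
  refine le_trans (le_of_eq ?_) (h.lyapunov_le hH₀ hH₁ hdens hgen ht)
  simp only [Function.comp_apply, lyapunov]
  rw [h.1.2.eq_propagator hU hH₀ hd ht]
  congr 2
  exact (norm_sub_freeEvolution hU (ρd 0) t).symm

/-- A trajectory that converges to one critical point stays away from the others. -/
lemma eventually_le_norm_sub_freeEvolution (hU : U ∈ Matrix.unitaryGroup (Fin n) ℂ)
    {x y : Mat n} {η : ℝ} (hη : 0 < η) (hxy : η ≤ ‖y - x‖)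
    (hlim : Tendsto (interaction U a ρ) atTop (𝓝 y)) :
    ∃ T : ℝ, 0 ≤ T ∧ ∀ t : ℝ, T ≤ t → η / 2 ≤ ‖ρ t - freeEvolution U a x t‖ := by
  have hc : Continuous fun z : Mat n => ‖z - x‖ := by fun_prop
  have h1 := ((hc.tendsto y).comp hlim).eventually_const_lt
    (show η / 2 < ‖y - x‖ by linarith)
  obtain ⟨T, hT⟩ := eventually_atTop.1 (h1.and (eventually_ge_atTop 0))
  refine ⟨T, (hT T le_rfl).2, fun t ht => ?_⟩
  rw [norm_sub_freeEvolution hU]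
  exact (hT t ht).1.le

lemma exists_separation {P : Mat n} {l : Fin n → ℝ} (hP : P ∈ Matrix.unitaryGroup (Fin n) ℂ)
    (hl : StrictMono l) :
    ∃ η : ℝ, 0 < η ∧ ∀ τ τ', τ ≠ τ' → η ≤ ‖permState P l τ - permState P l τ'‖ := by
  have h : ∀ᶠ η in 𝓝[>] (0 : ℝ), ∀ p : {p : Equiv.Perm (Fin n) × Equiv.Perm (Fin n) // p.1 ≠ p.2},
      η < ‖permState P l p.1.1 - permState P l p.1.2‖ := by
    refine eventually_all.2 fun p => nhdsWithin_le_nhds (Iio_mem_nhds ?_)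
    exact norm_pos_iff.2 (sub_ne_zero.2 ((permState_injective hP hl).ne p.2))
  obtain ⟨η, hη, hpos⟩ := (h.and self_mem_nhdsWithin).exists
  exact ⟨η, hpos, fun τ τ' hne => (hη ⟨(τ, τ'), hne⟩).le⟩

/-- If reversal were trivial, then `n ≤ 1` and all matrices would commute. Non-stationarity thus
separates the maximum of `V` from the target. -/
lemma revPerm_ne_one_of_lie_ne_zero {A B : Mat n} (h : ⁅A, B⁆ ≠ 0) :
    (Fin.revPerm : Equiv.Perm (Fin n)) ≠ 1 := by
  intro hrev
  have hsub : Subsingleton (Fin n) := ⟨fun i j => by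
    have hi : i.rev = i := congrArg (fun τ : Equiv.Perm (Fin n) => τ i) hrev
    have hj : j.rev = j := congrArg (fun τ : Equiv.Perm (Fin n) => τ j) hrev
    rw [Fin.ext_iff, Fin.val_rev] at hi hj
    ext
    omega⟩
  apply h
  rw [Ring.lie_def, sub_eq_zero]
  ext i j
  rw [Matrix.mul_apply, Matrix.mul_apply, Subsingleton.elim j i]
  refine Finset.sum_congr rfl fun k _ => ?_
  rw [Subsingleton.elim k i, mul_comm]

end stability

end LyapunovControl

/-! ### The main theorem -/

theorem mainTheorem5 {n : ℕ} (H₀ H₁ : LyapunovControl.Mat n)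
    (hH₀ : H₀.IsHermitian) (hH₁ : H₁.IsHermitian)
    (hideal : LyapunovControl.IsIdeal H₀ H₁)
    (ρd : ℝ → LyapunovControl.Mat n)
    (hρd : LyapunovControl.IsFreeTrajectory H₀ ρd)
    (hdens : LyapunovControl.IsDensity (ρd 0))
    (hgen : LyapunovControl.IsGeneric (ρd 0))
    (hnonstat : ⁅H₀, ρd 0⁆ ≠ 0)
    (hreg : LyapunovControl.IsRegular (LyapunovControl.laSalleSet H₀ H₁ ρd)) :
    ∃ c : Fin n.factorial → ℝ → LyapunovControl.Mat n,
      -- the `c k` are the critical trajectories, one for each critical point of `V(·, ρd(0))`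
      (∀ k, LyapunovControl.IsCriticalTrajectory H₀ ρd (c k)) ∧
      Function.Injective (fun k => c k 0) ∧
      Set.range (fun k => c k 0) = {ρ₀ | LyapunovControl.IsCriticalPoint (ρd 0) ρ₀} ∧
      -- they solve the closed-loop system and consist of critical points of `V(·, ρd(t))`
      (∀ k, LyapunovControl.IsAdmissible H₀ H₁ ρd (c k) ∧
        ∀ t : ℝ, 0 ≤ t → LyapunovControl.IsCriticalPoint (ρd t) (c k t)) ∧
      -- every trajectory converges to one of them
      (∀ ρ, LyapunovControl.IsAdmissible H₀ H₁ ρd ρ →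
        ∃ k, LyapunovControl.ConvergesTo ρ (c k)) ∧
      ∃ kmin kmax : Fin n.factorial, kmin ≠ kmax ∧
        -- `c kmin` is the target trajectory, which is locally asymptotically stable
        (∀ t : ℝ, 0 ≤ t → c kmin t = ρd t) ∧
        LyapunovControl.IsLocallyAsymptoticallyStable H₀ H₁ ρd (c kmin) ∧
        -- `c kmax` is the (unique) global maximum, which is repulsive
        (∀ ρ ∈ LyapunovControl.isospectral (ρd 0), ρ ≠ c kmax 0 →
          LyapunovControl.lyapunov ρ (ρd 0) < LyapunovControl.lyapunov (c kmax 0) (ρd 0)) ∧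
        LyapunovControl.IsRepulsive H₀ H₁ ρd (c kmax) ∧
        -- all critical trajectories other than the target are unstable
        (∀ k, k ≠ kmin → ¬ LyapunovControl.IsStable H₀ H₁ ρd (c k)) := by

  obtain ⟨U, hU, a, hUd, hω, -⟩ := hideal
  have hd : H₀ = U * Matrix.diagonal (fun k => (a k : ℂ)) * star U := by
    rw [← hUd, LyapunovControl.conj_conj_star hU]
  obtain ⟨P, hP, l, hl, hs⟩ :=
    LyapunovControl.exists_strictMono_diagonal hdens.1.isHermitian hgen
  replace hs : ρd 0 = LyapunovControl.permState P l 1 := hs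
  have hsd : LyapunovControl.IsDensity (LyapunovControl.permState P l 1) := hs ▸ hdens
  obtain ⟨η, hη, hsep⟩ := LyapunovControl.exists_separation hP hl
  let e : Fin n.factorial ≃ Equiv.Perm (Fin n) :=
    (Fintype.equivFinOfCardEq (by rw [Fintype.card_perm, Fintype.card_fin])).symm
  have hconv : ∀ ρ, LyapunovControl.IsAdmissible H₀ H₁ ρd ρ →
      ∃ k, Tendsto (LyapunovControl.interaction U a ρ) atTop
        (𝓝 (LyapunovControl.permState P l (e k))) := by
    intro ρ hρ
    obtain ⟨τ, hτ⟩ := hρ.exists_tendsto_interaction hH₀ hH₁ hU hd hω hdens hgen hreg hP hl hs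
    exact ⟨e.symm τ, by rwa [Equiv.apply_symm_apply]⟩
  have hto : ∀ {ρ : ℝ → LyapunovControl.Mat n} {x : LyapunovControl.Mat n},
      Tendsto (LyapunovControl.interaction U a ρ) atTop (𝓝 x) →
      LyapunovControl.ConvergesTo ρ (LyapunovControl.freeEvolution U a x) := fun hx =>
    (tendsto_iff_norm_sub_tendsto_zero.1 hx).congr fun t =>
      (LyapunovControl.norm_sub_freeEvolution hU _ t).symm
  have htarget : ∀ t : ℝ, 0 ≤ t →
      LyapunovControl.freeEvolution U a (LyapunovControl.permState P l 1) t = ρd t := by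
    intro t ht
    rw [hρd.eq_propagator hU hH₀ hd ht, hs, LyapunovControl.freeEvolution]
  refine ⟨fun k => LyapunovControl.freeEvolution U a (LyapunovControl.permState P l (e k)),
    fun k => ⟨LyapunovControl.isFreeTrajectory_propagator hU hd _, ?_⟩, ?_, ?_,
    fun k => ⟨?_, fun t ht => ?_⟩, fun ρ hρ => ?_, e.symm 1, e.symm Fin.revPerm, ?_, ?_,
    ⟨?_, ?_⟩, ?_, ?_, ?_⟩
  · simp only [LyapunovControl.freeEvolution_zero hU, hs]
    exact LyapunovControl.isCriticalPoint_permState hP hl hsd _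
  · intro k k' h
    simp only [LyapunovControl.freeEvolution_zero hU] at h
    exact e.injective (LyapunovControl.permState_injective hP hl h)
  · ext x
    simp only [LyapunovControl.freeEvolution_zero hU, hs, mem_ofPred_eq,
      LyapunovControl.isCriticalPoint_iff hP hl hsd]
    constructor
    · rintro ⟨k, rfl⟩
      exact ⟨e k, rfl⟩
    · rintro ⟨τ, rfl⟩
      exact ⟨e.symm τ, by simp⟩
  · refine LyapunovControl.isAdmissible_freeEvolution hU hH₀ hd hρd ?_ ?_
    · rw [hs]
      exact LyapunovControl.permState_mem_isospectral hP hsd _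
    · rw [hs]
      exact LyapunovControl.lie_permState hP _ _
  · rw [← htarget t ht]
    exact LyapunovControl.isCriticalPoint_freeEvolution hU hP hl hsd _ t
  · obtain ⟨k, hk⟩ := hconv ρ hρ
    exact ⟨k, hto hk⟩
  · exact fun h => LyapunovControl.revPerm_ne_one_of_lie_ne_zero hnonstat
      (e.symm.injective h).symm
  · intro t ht
    simp only [Equiv.apply_symm_apply, htarget t ht]
  -- Here `V` is half the squared distance to the target, which never increases, so `δ = ε` works.
  · intro ε hε
    refine ⟨ε, hε, fun ρ hρ h0 t ht => ?_⟩
    simp only [Equiv.apply_symm_apply] at h0 ⊢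
    rw [htarget t ht]
    rw [htarget 0 le_rfl] at h0
    have h1 := hρ.lyapunov_le hH₀ hH₁ hdens hgen ht
    simp only [LyapunovControl.lyapunov] at h1
    exact (abs_le_of_sq_le_sq' (by linarith) (norm_nonneg _)).2.trans_lt h0
  -- The limit is no farther from the target than the start, and no other critical point lies within
  -- the separation `η`.
  · refine ⟨η, hη, fun ρ hρ h0 => ?_⟩
    simp only [Equiv.apply_symm_apply, LyapunovControl.freeEvolution_zero hU] at h0 ⊢
    obtain ⟨k, hk⟩ := hconv ρ hρ
    have h1 := hρ.lyapunov_limit_le hH₀ hH₁ hU hd hdens hgen hk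
    simp only [LyapunovControl.lyapunov, hs] at h1
    have h2 := (abs_le_of_sq_le_sq' (by linarith) (norm_nonneg _)).2.trans_lt h0
    have h3 : e k = 1 := by
      by_contra hne
      exact absurd (hsep _ _ hne) (not_le.2 h2)
    rw [h3] at hk
    exact hto hk
  · intro ρ hρ hne
    simp only [Equiv.apply_symm_apply, LyapunovControl.freeEvolution_zero hU] at hne ⊢
    rw [hs] at hρ ⊢
    exact LyapunovControl.lyapunov_lt_permState_rev hP hl hsd hρ hne
  -- Closeness to the maximum plays no role: every trajectory not starting at it has smaller `V` and
  -- so converges to another critical point, at distance at least `η`.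
  · refine ⟨η / 2, by positivity, fun ρ hρ hne _ => ?_⟩
    simp only [Equiv.apply_symm_apply, LyapunovControl.freeEvolution_zero hU] at hne ⊢
    obtain ⟨k, hk⟩ := hconv ρ hρ
    have h1 := hρ.lyapunov_limit_le hH₀ hH₁ hU hd hdens hgen hk
    have hρ0 := hρ.2
    rw [hs] at h1 hρ0
    have h2 := LyapunovControl.lyapunov_lt_permState_rev hP hl hsd hρ0 hne
    have h3 : e k ≠ Fin.revPerm := by
      intro h
      rw [h] at h1
      exact absurd h2 (not_lt.2 h1)
    exact LyapunovControl.eventually_le_norm_sub_freeEvolution hU hη (hsep _ _ h3) hk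
  -- A nearby start with strictly smaller `V` cannot return to the critical point, so it ends at
  -- another one and violates the bound `η / 2`.
  · intro k hk hstable
    have hek : e k ≠ 1 := fun h => hk (by rw [← h, Equiv.symm_apply_apply])
    obtain ⟨δ, hδ, hst⟩ := hstable (η / 2) (by positivity)
    obtain ⟨y, hy, hyδ, hlt⟩ := LyapunovControl.exists_lyapunov_lt hP hl hsd hek hδ
    rw [← hs] at hy hlt
    obtain ⟨ρ, hρ, rfl⟩ := LyapunovControl.exists_isAdmissible hH₀ hH₁ hρd hy
    obtain ⟨k', hk'⟩ := hconv ρ hρ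
    have h1 := hρ.lyapunov_limit_le hH₀ hH₁ hU hd hdens hgen hk'
    have h3 : e k' ≠ e k := by
      intro h
      rw [h] at h1
      exact absurd hlt (not_lt.2 h1)
    obtain ⟨T, hT0, hT⟩ :=
      LyapunovControl.eventually_le_norm_sub_freeEvolution hU hη (hsep _ _ h3) hk'
    have h4 := hst ρ hρ (by simpa only [LyapunovControl.freeEvolution_zero hU] using hyδ) T hT0
    exact absurd h4 (not_lt.2 (hT T le_rfl))
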